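/- Let $k$ be an odd positive integer, $n=5k$, and $d=2^{4k}+2^{3k}+2^{2k}+2^{k}-1$. Regard $\mathbb{F}_{2^k}$ as a subfield of $\mathbb{F}_{2^n}$. Let $m\in\{k-1,\ \tfrac{k+1}{2},\ 2\}$ with $m\ge 1$ (this excludes only the case $k=1$, $m=k-1=0$), let $\mathcal{L}_1,\mathcal{L}_2$ be affine permutations of $\mathbb{F}_{2^k}$ (bijections that are affine over $\mathbb{F}_2$), and let $g=\mathcal{L}_1\circ x^{2^m-1}\circ\mathcal{L}_2$ on $\mathbb{F}_{2^k}$, extended in any way to a function $g:\mathbb{F}_{2^n}\to\mathbb{F}_{2^n}$ (for example by evaluating a polynomial representing $g$; the function $f$ below does not depend on the extension). Define $$f(x)=g(x)+\bigl(g(x)+x^{d}\bigr)\bigl(x+x^{2^k}\bigr)^{2^n-1},\qquad x\in\mathbb{F}_{2^n}.$$ Then $f$ is a permutation of $\mathbb{F}_{2^n}$, and $f$ is differentially $4$-uniform in the sense that for all $a\in\mathbb{F}_{2^n}\setminus\{0\}$ and $b\in\mathbb{F}_{2^n}$ the equation $f(x+a)+f(x)=b$ has at most $4$ solutions $x\in\mathbb{F}_{2^n}$;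 that is, the differential uniformity $\max_{a\neq 0,\,b}\bigl|\{x\in\mathbb{F}_{2^n}: f(x+a)+f(x)=b\}\bigr|$ of $f$ is at most $4$. -/

import Mathlib

/-- `derivCount f a b` is the number `δ_f(a, b)` of solutions `x` of `f (x + a) + f x = b`
(in characteristic two, `f (x + a) + f x` is the derivative of `f` in direction `a`). -/
noncomputable def derivCount {F : Type*} [Field F] (f : F → F) (a b : F) : ℕ :=
  Nat.card {x : F // f (x + a) + f x = b}

open Classical in
/-- The differential uniformity of `f`: the maximum of `δ_f(a, b)` over all `a ≠ 0` and all `b`. -/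
noncomputable def differentialUniformity {F : Type*} [Field F] [Fintype F] (f : F → F) : ℕ :=
  ((Finset.univ : Finset (F × F)).filter (fun p => p.1 ≠ 0)).sup (fun p => derivCount f p.1 p.2)

/-- A function `f` on a finite field of characteristic two is differentially `δ`-uniform if
`f (x + a) + f x = b` has at most `δ` solutions `x`, for all `a ≠ 0` and all `b`. -/
def IsDifferentiallyUniform {F : Type*} [Field F] [Fintype F] (δ : ℕ) (f : F → F) : Prop :=
  differentialUniformity f ≤ δ

/-- The exponent of the Dobbertin power function on the field with `2 ^ (5 * k)` elements. -/
def dobbertinExp (k : ℕ) : ℕ :=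
  2 ^ (4 * k) + 2 ^ (3 * k) + 2 ^ (2 * k) + 2 ^ k - 1

/-- The function `x ↦ g x + (g x + x ^ d) * (x + x ^ (2 ^ k)) ^ (2 ^ n - 1)` with `n = 5 * k`
and `d` the Dobbertin exponent. -/
def modifiedDobbertin {F : Type*} [Field F] (k : ℕ) (g : F → F) (x : F) : F :=
  g x + (g x + x ^ dobbertinExp k) * (x + x ^ (2 ^ k)) ^ (2 ^ (5 * k) - 1)

/-! ### Polynomials over the fixed field of an automorphism of order five -/

section Orbit

open Polynomial

variable {F : Type*} [Field F]

/-! Put q = 2^k, φ(x) = x^q, K the fixed field of φ and N the norm `conjNorm` to K. Since d + 2 = 1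
+ q + q² + q³ + q⁴, the map P(x) = x^d satisfies P(x) x² = N(x). The function f is g on K and P off
K, so the two are studied separately and then glued. The recurrent tool is that an element outside K
has degree five over K, so it kills no nonzero polynomial over K of degree at most four.

Almost perfect nonlinearity of P (`dobbertin_apn`): suppose four distinct points with sum zero have
P-values with sum zero. If none is zero, square roots of the norms give A, B, D, E in K with A/x +
B/y + D/z + E/w = 0. Then x, y, z are independent over K. Their six quadratic monomials lie in a
space of dimension five, so (x : y : z) lies on a conic over K and x, y, z, w become u times
quadratic forms X, Y, Z, W at some τ outside K. The relation turns into a sextic form over K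
vanishing at τ: a linear form times the five conjugate factors. Multiplying its values at the two
roots of X evaluates X at the root of the linear form as N(u) times the resultants of X with the
other forms. The relations X + Y + Z + W = 0 and the conic equation, evaluated there, force
symmetric expressions in the six resultants to vanish. These expressions compute det(X, Y, Z)⁴,
which is nonzero (`false_of_conic_parametrization`). A vanishing resultant is excluded beforehand
(`conic_coeffs_eq_zero`).

On K, the map x^(2^m - 1) is almost perfect nonlinear because each derivative equation implies a
quartic with roots 0, 1, s, s + 1 (`pow_two_pow_sub_one_apn`); affine permutations preserve this.

Gluing: by `eq_of_add_fixed`, each of the two mixed kinds of solutions (exactly one of x, x + a in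
K) contributes at most one, giving 2 + 2 solutions for a in K and 1 + 1 + 2 otherwise. Bijectivity
follows from N(P(x)) = N(x)³, injectivity of cubing on K for odd k, and the fact that P(y) in K
forces y in K. -/

/-- The product of the five iterates of a ring endomorphism. -/
def conjNorm (φ : F →+* F) (x : F) : F :=
  x * φ x * φ (φ x) * φ (φ (φ x)) * φ (φ (φ (φ x)))

theorem conjNorm_mul (φ : F →+* F) (x y : F) :
    conjNorm φ (x * y) = conjNorm φ x * conjNorm φ y := by
  simp only [conjNorm, map_mul]; ring

theorem conjNorm_of_fixed {φ : F →+* F} {c : F} (hc : φ c = c) : conjNorm φ c = c ^ 5 := by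
  simp only [conjNorm, hc]; ring

theorem conjNorm_ne_zero {φ : F →+* F} {x : F} (hx : x ≠ 0) : conjNorm φ x ≠ 0 := by
  simp [conjNorm, hx]

/-- Powers of an automorphism of order five take five values at a point that is not fixed. -/
theorem iterate_injOn_range_five {φ : F →+* F} (h5 : ∀ x, φ (φ (φ (φ (φ x)))) = x) {τ : F}
    (hτ : φ τ ≠ τ) : Set.InjOn (fun i => φ^[i] τ) (Finset.range 5) := by
  have hp : Function.IsPeriodicPt φ 5 τ := h5 τ
  have hd := hp.minimalPeriod_dvd
  rcases (Nat.dvd_prime Nat.prime_five).1 hd with h | h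
  · exact absurd (Function.minimalPeriod_eq_one_iff_isFixedPt.1 h) hτ
  · have := Function.iterate_injOn_Iio_minimalPeriod (f := φ) (x := τ)
    rw [h] at this
    refine this.mono ?_
    intro i hi
    simpa using hi

theorem eval_map_iterate {φ : F →+* F} {P : F[X]} (hP : P.map φ = P) {τ : F}
    (h0 : P.eval τ = 0) (i : ℕ) : P.eval (φ^[i] τ) = 0 := by
  induction i with
  | zero => simpa using h0
  | succ i ih =>
    rw [Function.iterate_succ_apply', ← hP, eval_map_apply, ih, map_zero]

/-- Each of the five distinct conjugates of `τ` is a root, and the corresponding linear factors are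
pairwise coprime. -/
theorem exists_eq_orbit_prod_mul {φ : F →+* F} (h5 : ∀ x, φ (φ (φ (φ (φ x)))) = x) {τ : F}
    (hτ : φ τ ≠ τ) {P : F[X]} (hP : P.map φ = P) (h0 : P.eval τ = 0) :
    ∃ Q : F[X], P = (∏ i ∈ Finset.range 5, (X - C (φ^[i] τ))) * Q ∧
      Q.natDegree ≤ P.natDegree - 5 ∧ (P.natDegree < 5 → P = 0) := by
  have hdvd : (∏ i ∈ Finset.range 5, (X - C (φ^[i] τ))) ∣ P := by
    refine Finset.prod_dvd_of_coprime ?_ fun i _ => dvd_iff_isRoot.2 (eval_map_iterate hP h0 i)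
    intro i hi j hj hij
    exact isCoprime_X_sub_C_of_isUnit_sub
      (sub_ne_zero.2 fun h => hij (iterate_injOn_range_five h5 hτ hi hj h)).isUnit
  have hmon : (∏ i ∈ Finset.range 5, (X - C (φ^[i] τ))).Monic :=
    monic_prod_of_monic _ _ fun i _ => monic_X_sub_C _
  have hdeg : (∏ i ∈ Finset.range 5, (X - C (φ^[i] τ))).natDegree = 5 := by
    rw [natDegree_prod_of_monic _ _ fun i _ => monic_X_sub_C _]
    simp
  obtain ⟨Q, hQ⟩ := hdvd
  refine ⟨Q, hQ, ?_, fun hlt => ?_⟩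
  · rcases eq_or_ne Q 0 with rfl | hQ0
    · simp
    · rw [hQ, hmon.natDegree_mul' hQ0, hdeg]
      omega
  · by_contra hne
    have hQ0 : Q ≠ 0 := by
      rintro rfl
      simp_all
    rw [hQ, hmon.natDegree_mul' hQ0, hdeg] at hlt
    omega

theorem coeff_eq_zero_of_quartic {φ : F →+* F} (h5 : ∀ x, φ (φ (φ (φ (φ x)))) = x) {τ : F}
    (hτ : φ τ ≠ τ) {c4 c3 c2 c1 c0 : F} (f4 : φ c4 = c4) (f3 : φ c3 = c3)
    (f2 : φ c2 = c2) (f1 : φ c1 = c1) (f0 : φ c0 = c0)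
    (h : c4 * τ ^ 4 + c3 * τ ^ 3 + c2 * τ ^ 2 + c1 * τ + c0 = 0) :
    c4 = 0 ∧ c3 = 0 ∧ c2 = 0 ∧ c1 = 0 ∧ c0 = 0 := by
  set P : F[X] := C c4 * X ^ 4 + C c3 * X ^ 3 + C c2 * X ^ 2 + C c1 * X + C c0 with hPdef
  have hP : P.map φ = P := by simp [hPdef, f4, f3, f2, f1, f0]
  have h0 : P.eval τ = 0 := by simpa [hPdef] using h
  have hdeg : P.natDegree ≤ 4 := by rw [hPdef]; compute_degree
  obtain ⟨Q, -, -, hz⟩ := exists_eq_orbit_prod_mul h5 hτ hP h0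
  have hz := hz (by omega)
  refine ⟨?_, ?_, ?_, ?_, ?_⟩
  · simpa [hPdef, coeff_X, coeff_C] using congrArg (coeff · 4) hz
  · simpa [hPdef, coeff_X, coeff_C] using congrArg (coeff · 3) hz
  · simpa [hPdef, coeff_X, coeff_C] using congrArg (coeff · 2) hz
  · simpa [hPdef, coeff_X, coeff_C] using congrArg (coeff · 1) hz
  · simpa [hPdef, coeff_X, coeff_C] using congrArg (coeff · 0) hz

theorem coeff_eq_zero_of_cubic {φ : F →+* F} (h5 : ∀ x, φ (φ (φ (φ (φ x)))) = x) {τ : F}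
    (hτ : φ τ ≠ τ) {c3 c2 c1 c0 : F} (f3 : φ c3 = c3)
    (f2 : φ c2 = c2) (f1 : φ c1 = c1) (f0 : φ c0 = c0)
    (h : c3 * τ ^ 3 + c2 * τ ^ 2 + c1 * τ + c0 = 0) : c3 = 0 ∧ c2 = 0 ∧ c1 = 0 ∧ c0 = 0 :=
  (coeff_eq_zero_of_quartic h5 hτ (map_zero φ) f3 f2 f1 f0 (by linear_combination h)).2

theorem coeff_eq_zero_of_quadratic {φ : F →+* F} (h5 : ∀ x, φ (φ (φ (φ (φ x)))) = x) {τ : F}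
    (hτ : φ τ ≠ τ) {c2 c1 c0 : F}
    (f2 : φ c2 = c2) (f1 : φ c1 = c1) (f0 : φ c0 = c0)
    (h : c2 * τ ^ 2 + c1 * τ + c0 = 0) : c2 = 0 ∧ c1 = 0 ∧ c0 = 0 :=
  (coeff_eq_zero_of_cubic h5 hτ (map_zero φ) f2 f1 f0 (by linear_combination h)).2

theorem orbit_prod_expand (a b c d e : F) :
    (X - C a) * (X - C b) * (X - C c) * (X - C d) * (X - C e) =
      X ^ 5 + C (-(a + b + c + d + e)) * X ^ 4
      + C (a*b + a*c + a*d + a*e + b*c + b*d + b*e + c*d + c*e + d*e) * X ^ 3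
      + C (-(a*b*c + a*b*d + a*b*e + a*c*d + a*c*e + a*d*e + b*c*d + b*c*e + b*d*e + c*d*e)) * X ^ 2
      + C (a*b*c*d + a*b*c*e + a*b*d*e + a*c*d*e + b*c*d*e) * X + C (-(a*b*c*d*e)) := by
  simp only [map_add, map_mul, map_neg]; ring

/-- A binary sextic form with coefficients fixed by `φ` that vanishes at `τ` is the product of a
linear form and the linear forms vanishing at the conjugates of `τ`. -/
theorem exists_sextic_factor {Ω : Type*} [Field Ω] (ι : F →+* Ω)
    {φ : F →+* F} (h5 : ∀ x, φ (φ (φ (φ (φ x)))) = x) {τ : F}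
    (hτ : φ τ ≠ τ) {c6 c5 c4 c3 c2 c1 c0 : F}
    (f6 : φ c6 = c6) (f5 : φ c5 = c5) (f4 : φ c4 = c4) (f3 : φ c3 = c3)
    (f2 : φ c2 = c2) (f1 : φ c1 = c1) (f0 : φ c0 = c0)
    (h : c6 * τ ^ 6 + c5 * τ ^ 5 + c4 * τ ^ 4 + c3 * τ ^ 3 + c2 * τ ^ 2 + c1 * τ + c0 = 0) :
    ∃ l0 : F, (c6 = 0 → l0 = c5) ∧ ∀ s t : Ω, ι c6 * s ^ 6 + ι c5 * s ^ 5 * t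
        + ι c4 * s ^ 4 * t ^ 2 + ι c3 * s ^ 3 * t ^ 3 + ι c2 * s ^ 2 * t ^ 4 + ι c1 * s * t ^ 5
        + ι c0 * t ^ 6 =
      (ι c6 * s + ι l0 * t) * ((s - ι τ * t) * (s - ι (φ τ) * t) * (s - ι (φ (φ τ)) * t)
        * (s - ι (φ (φ (φ τ))) * t) * (s - ι (φ (φ (φ (φ τ)))) * t)) := by
  set P : F[X] := C c6 * X ^ 6 + C c5 * X ^ 5 + C c4 * X ^ 4 + C c3 * X ^ 3 + C c2 * X ^ 2
    + C c1 * X + C c0 with hPdef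
  have hP : P.map φ = P := by simp [hPdef, f6, f5, f4, f3, f2, f1, f0]
  have h0 : P.eval τ = 0 := by simpa [hPdef] using h
  have hdeg : P.natDegree ≤ 6 := by rw [hPdef]; compute_degree
  obtain ⟨Q, hQ, hQd, -⟩ := exists_eq_orbit_prod_mul h5 hτ hP h0
  have hQ1 : Q.natDegree ≤ 1 := by omega
  obtain ⟨l1, l0, rfl⟩ := exists_eq_X_add_C_of_natDegree_le_one hQ1
  have hprod : (∏ i ∈ Finset.range 5, (X - C (φ^[i] τ))) = (X - C τ) * (X - C (φ τ))
      * (X - C (φ (φ τ))) * (X - C (φ (φ (φ τ)))) * (X - C (φ (φ (φ (φ τ))))) := by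
    simp [Finset.prod_range_succ]
  rw [hprod, orbit_prod_expand] at hQ
  generalize φ τ = τ1 at *
  generalize φ τ1 = τ2 at *
  generalize φ τ2 = τ3 at *
  generalize φ τ3 = τ4 at *
  generalize e1 : -(τ + τ1 + τ2 + τ3 + τ4) = s1 at hQ
  generalize e2 : (τ*τ1 + τ*τ2 + τ*τ3 + τ*τ4 + τ1*τ2 + τ1*τ3 + τ1*τ4 + τ2*τ3 + τ2*τ4 + τ3*τ4)
    = s2 at hQ
  generalize e3 : -(τ*τ1*τ2 + τ*τ1*τ3 + τ*τ1*τ4 + τ*τ2*τ3 + τ*τ2*τ4 + τ*τ3*τ4 + τ1*τ2*τ3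
    + τ1*τ2*τ4 + τ1*τ3*τ4 + τ2*τ3*τ4) = s3 at hQ
  generalize e4 : (τ*τ1*τ2*τ3 + τ*τ1*τ2*τ4 + τ*τ1*τ3*τ4 + τ*τ2*τ3*τ4 + τ1*τ2*τ3*τ4) = s4 at hQ
  generalize e5 : -(τ*τ1*τ2*τ3*τ4) = s5 at hQ
  have hQ' : P = C l1 * X ^ 6 + C (l0 + l1 * s1) * X ^ 5 + C (l0 * s1 + l1 * s2) * X ^ 4
      + C (l0 * s2 + l1 * s3) * X ^ 3 + C (l0 * s3 + l1 * s4) * X ^ 2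
      + C (l0 * s4 + l1 * s5) * X + C (l0 * s5) := by
    rw [hQ]; simp only [map_add, map_mul]; ring
  rw [hPdef] at hQ'
  have k6 : c6 = l1 := by simpa [coeff_X, coeff_C, -map_add, -map_mul] using congrArg (coeff · 6) hQ'
  have k5 : c5 = l0 + l1 * s1 := by simpa [coeff_X, coeff_C, -map_add, -map_mul] using congrArg (coeff · 5) hQ'
  have k4 : c4 = l0 * s1 + l1 * s2 := by
    simpa [coeff_X, coeff_C, -map_add, -map_mul] using congrArg (coeff · 4) hQ'
  have k3 : c3 = l0 * s2 + l1 * s3 := by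
    simpa [coeff_X, coeff_C, -map_add, -map_mul] using congrArg (coeff · 3) hQ'
  have k2 : c2 = l0 * s3 + l1 * s4 := by
    simpa [coeff_X, coeff_C, -map_add, -map_mul] using congrArg (coeff · 2) hQ'
  have k1 : c1 = l0 * s4 + l1 * s5 := by
    simpa [coeff_X, coeff_C, -map_add, -map_mul] using congrArg (coeff · 1) hQ'
  have k0 : c0 = l0 * s5 := by simpa [coeff_X, coeff_C, -map_add, -map_mul] using congrArg (coeff · 0) hQ'
  refine ⟨l0, fun hc => ?_, fun s t => ?_⟩
  · rw [k5, ← k6, hc]; ring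
  · rw [k6, k5, k4, k3, k2, k1, k0, ← e1, ← e2, ← e3, ← e4, ← e5]
    simp only [map_add, map_mul, map_neg]
    ring

/-- Multiplying by t gives a sextic with leading coefficient zero, whose extra linear factor is then
`ι c5 * t`. -/
theorem quintic_factor {Ω : Type*} [Field Ω] (ι : F →+* Ω)
    {φ : F →+* F} (h5 : ∀ x, φ (φ (φ (φ (φ x)))) = x) {τ : F}
    (hτ : φ τ ≠ τ) {c5 c4 c3 c2 c1 c0 : F}
    (f5 : φ c5 = c5) (f4 : φ c4 = c4) (f3 : φ c3 = c3)
    (f2 : φ c2 = c2) (f1 : φ c1 = c1) (f0 : φ c0 = c0)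
    (h : c5 * τ ^ 5 + c4 * τ ^ 4 + c3 * τ ^ 3 + c2 * τ ^ 2 + c1 * τ + c0 = 0) (s t : Ω) :
    ι c5 * s ^ 5 + ι c4 * s ^ 4 * t + ι c3 * s ^ 3 * t ^ 2 + ι c2 * s ^ 2 * t ^ 3
        + ι c1 * s * t ^ 4 + ι c0 * t ^ 5 =
      ι c5 * ((s - ι τ * t) * (s - ι (φ τ) * t) * (s - ι (φ (φ τ)) * t)
        * (s - ι (φ (φ (φ τ))) * t) * (s - ι (φ (φ (φ (φ τ)))) * t)) := by
  obtain ⟨l0, hl, H⟩ := exists_sextic_factor ι h5 hτ (map_zero φ) f5 f4 f3 f2 f1 f0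
    (by linear_combination h)
  obtain rfl := hl rfl
  rcases eq_or_ne t 0 with rfl | ht
  · ring
  · refine mul_right_cancel₀ ht ?_
    have := H s t
    rw [map_zero] at this
    linear_combination this

end Orbit

/-! ### Binary quadratic forms and resultants in characteristic two -/

/-- A binary quadratic form `c2 s² + c1 s t + c0 t²`. -/
structure BinQuad (R : Type*) where
  (c2 c1 c0 : R)

namespace BinQuad

variable {R S : Type*} [CommRing R] [CommRing S]

/-- The value of a binary quadratic form. -/
def eval (p : BinQuad R) (s t : R) : R := p.c2 * s ^ 2 + p.c1 * s * t + p.c0 * t ^ 2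

/-- The image of a binary quadratic form under a ring homomorphism. -/
def map (ι : R →+* S) (p : BinQuad R) : BinQuad S := ⟨ι p.c2, ι p.c1, ι p.c0⟩

/-- The resultant of two binary quadratic forms in characteristic two. -/
def res (p q : BinQuad R) : R :=
  (p.c2 * q.c0 + p.c0 * q.c2) ^ 2
    + (p.c2 * q.c1 + p.c1 * q.c2) * (p.c1 * q.c0 + p.c0 * q.c1)

/-- All coefficients are fixed by `φ`. -/
def IsFixed (φ : R →+* R) (p : BinQuad R) : Prop := φ p.c2 = p.c2 ∧ φ p.c1 = p.c1 ∧ φ p.c0 = p.c0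

/-- The sum of two binary quadratic forms. -/
def add (p q : BinQuad R) : BinQuad R := ⟨p.c2 + q.c2, p.c1 + q.c1, p.c0 + q.c0⟩

theorem eval_map (ι : R →+* S) (p : BinQuad R) (s t : R) :
    (p.map ι).eval (ι s) (ι t) = ι (p.eval s t) := by
  simp [eval, map]

theorem res_map (ι : R →+* S) (p q : BinQuad R) : (p.map ι).res (q.map ι) = ι (p.res q) := by
  simp [res, map]

theorem IsFixed.apply_eval {φ : R →+* R} {p : BinQuad R} (hp : p.IsFixed φ) (s : R) :
    φ (p.eval s 1) = p.eval (φ s) 1 := by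
  simp [eval, hp.1, hp.2.1, hp.2.2]

theorem IsFixed.res {φ : R →+* R} {p q : BinQuad R} (hp : p.IsFixed φ) (hq : q.IsFixed φ) :
    φ (p.res q) = p.res q := by
  simp [BinQuad.res, hp.1, hp.2.1, hp.2.2, hq.1, hq.2.1, hq.2.2]

theorem res_comm (p q : BinQuad R) : p.res q = q.res p := by simp only [res]; ring

section CharTwo

variable {F Ω : Type*} [Field F] [Field Ω]

theorem exists_linear_factors [IsAlgClosed Ω] [CharP Ω 2] (p : BinQuad Ω) :
    ∃ a1 a0 b1 b0 : Ω, p = ⟨a1 * b1, a1 * b0 + a0 * b1, a0 * b0⟩ := by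
  obtain ⟨p2, p1, p0⟩ := p
  rcases eq_or_ne p2 0 with rfl | h2
  · exact ⟨0, 1, p1, p0, by simp⟩
  · obtain ⟨ρ, hρ⟩ := IsAlgClosed.exists_root
      (Polynomial.C p2 * Polynomial.X ^ 2 + Polynomial.C p1 * Polynomial.X + Polynomial.C p0)
      (by rw [Polynomial.degree_quadratic h2]; decide)
    have hρ : p2 * ρ ^ 2 + p1 * ρ + p0 = 0 := by simpa using hρ
    refine ⟨1, ρ, p2, p1 + p2 * ρ, ?_⟩
    have e1 : p1 = 1 * (p1 + p2 * ρ) + ρ * p2 := by grind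
    have e0 : p0 = ρ * (p1 + p2 * ρ) := by grind
    rw [← e1, ← e0, one_mul]

theorem eval_factors (a1 a0 b1 b0 : Ω) (s t : Ω) :
    (⟨a1 * b1, a1 * b0 + a0 * b1, a0 * b0⟩ : BinQuad Ω).eval s t
      = (a1 * s + a0 * t) * (b1 * s + b0 * t) := by
  simp only [eval]; ring

/-- The roots of the first form are (a0 : a1) and (b0 : b1), signs being irrelevant, and the
resultant is the product of the values of `q` there. -/
theorem res_factors [CharP Ω 2] (a1 a0 b1 b0 : Ω) (q : BinQuad Ω) :
    (⟨a1 * b1, a1 * b0 + a0 * b1, a0 * b0⟩ : BinQuad Ω).res q = q.eval a0 a1 * q.eval b0 b1 := by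
  simp only [eval, res]; grind

set_option linter.unusedSimpArgs false in
theorem exists_cubic_factor (ι : F →+* Ω) {φ : F →+* F}
    (h5 : ∀ x, φ (φ (φ (φ (φ x)))) = x) {τ : F} (hτ : φ τ ≠ τ) {X Y Z W : BinQuad F}
    (hX : X.IsFixed φ) (hY : Y.IsFixed φ) (hZ : Z.IsFixed φ) (hW : W.IsFixed φ) {A B D E : F}
    (hA : φ A = A) (hB : φ B = B) (hD : φ D = D) (hE : φ E = E)
    (h : A * (Y.eval τ 1 * Z.eval τ 1 * W.eval τ 1) + B * (X.eval τ 1 * Z.eval τ 1 * W.eval τ 1)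
      + D * (X.eval τ 1 * Y.eval τ 1 * W.eval τ 1)
      + E * (X.eval τ 1 * Y.eval τ 1 * Z.eval τ 1) = 0) :
    ∃ l1 l0 : F, ∀ s t : Ω,
      ι A * ((Y.map ι).eval s t * (Z.map ι).eval s t * (W.map ι).eval s t)
      + ι B * ((X.map ι).eval s t * (Z.map ι).eval s t * (W.map ι).eval s t)
      + ι D * ((X.map ι).eval s t * (Y.map ι).eval s t * (W.map ι).eval s t)
      + ι E * ((X.map ι).eval s t * (Y.map ι).eval s t * (Z.map ι).eval s t) =
      (ι l1 * s + ι l0 * t) * ((s - ι τ * t) * (s - ι (φ τ) * t) * (s - ι (φ (φ τ)) * t)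
        * (s - ι (φ (φ (φ τ))) * t) * (s - ι (φ (φ (φ (φ τ)))) * t)) := by
  obtain ⟨X2, X1, X0⟩ := hX
  obtain ⟨Y2, Y1, Y0⟩ := hY
  obtain ⟨Z2, Z1, Z0⟩ := hZ
  obtain ⟨W2, W1, W0⟩ := hW
  obtain ⟨l0, -, H⟩ := exists_sextic_factor ι h5 hτ
    (c6 := A * (Y.c2*Z.c2*W.c2) + B * (X.c2*Z.c2*W.c2)
      + D * (X.c2*Y.c2*W.c2) + E * (X.c2*Y.c2*Z.c2))
    (c5 := A * (Y.c1*Z.c2*W.c2 + Y.c2*Z.c1*W.c2 + Y.c2*Z.c2*W.c1) + B * (X.c1*Z.c2*W.c2 + X.c2*Z.c1*W.c2 + X.c2*Z.c2*W.c1)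
      + D * (X.c1*Y.c2*W.c2 + X.c2*Y.c1*W.c2 + X.c2*Y.c2*W.c1) + E * (X.c1*Y.c2*Z.c2 + X.c2*Y.c1*Z.c2 + X.c2*Y.c2*Z.c1))
    (c4 := A * (Y.c0*Z.c2*W.c2 + Y.c1*Z.c1*W.c2 + Y.c1*Z.c2*W.c1 + Y.c2*Z.c0*W.c2 + Y.c2*Z.c1*W.c1 + Y.c2*Z.c2*W.c0) + B * (X.c0*Z.c2*W.c2 + X.c1*Z.c1*W.c2 + X.c1*Z.c2*W.c1 + X.c2*Z.c0*W.c2 + X.c2*Z.c1*W.c1 + X.c2*Z.c2*W.c0)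
      + D * (X.c0*Y.c2*W.c2 + X.c1*Y.c1*W.c2 + X.c1*Y.c2*W.c1 + X.c2*Y.c0*W.c2 + X.c2*Y.c1*W.c1 + X.c2*Y.c2*W.c0) + E * (X.c0*Y.c2*Z.c2 + X.c1*Y.c1*Z.c2 + X.c1*Y.c2*Z.c1 + X.c2*Y.c0*Z.c2 + X.c2*Y.c1*Z.c1 + X.c2*Y.c2*Z.c0))
    (c3 := A * (Y.c0*Z.c1*W.c2 + Y.c0*Z.c2*W.c1 + Y.c1*Z.c0*W.c2 + Y.c1*Z.c1*W.c1 + Y.c1*Z.c2*W.c0 + Y.c2*Z.c0*W.c1 + Y.c2*Z.c1*W.c0) + B * (X.c0*Z.c1*W.c2 + X.c0*Z.c2*W.c1 + X.c1*Z.c0*W.c2 + X.c1*Z.c1*W.c1 + X.c1*Z.c2*W.c0 + X.c2*Z.c0*W.c1 + X.c2*Z.c1*W.c0)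
      + D * (X.c0*Y.c1*W.c2 + X.c0*Y.c2*W.c1 + X.c1*Y.c0*W.c2 + X.c1*Y.c1*W.c1 + X.c1*Y.c2*W.c0 + X.c2*Y.c0*W.c1 + X.c2*Y.c1*W.c0) + E * (X.c0*Y.c1*Z.c2 + X.c0*Y.c2*Z.c1 + X.c1*Y.c0*Z.c2 + X.c1*Y.c1*Z.c1 + X.c1*Y.c2*Z.c0 + X.c2*Y.c0*Z.c1 + X.c2*Y.c1*Z.c0))
    (c2 := A * (Y.c0*Z.c0*W.c2 + Y.c0*Z.c1*W.c1 + Y.c0*Z.c2*W.c0 + Y.c1*Z.c0*W.c1 + Y.c1*Z.c1*W.c0 + Y.c2*Z.c0*W.c0) + B * (X.c0*Z.c0*W.c2 + X.c0*Z.c1*W.c1 + X.c0*Z.c2*W.c0 + X.c1*Z.c0*W.c1 + X.c1*Z.c1*W.c0 + X.c2*Z.c0*W.c0)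
      + D * (X.c0*Y.c0*W.c2 + X.c0*Y.c1*W.c1 + X.c0*Y.c2*W.c0 + X.c1*Y.c0*W.c1 + X.c1*Y.c1*W.c0 + X.c2*Y.c0*W.c0) + E * (X.c0*Y.c0*Z.c2 + X.c0*Y.c1*Z.c1 + X.c0*Y.c2*Z.c0 + X.c1*Y.c0*Z.c1 + X.c1*Y.c1*Z.c0 + X.c2*Y.c0*Z.c0))
    (c1 := A * (Y.c0*Z.c0*W.c1 + Y.c0*Z.c1*W.c0 + Y.c1*Z.c0*W.c0) + B * (X.c0*Z.c0*W.c1 + X.c0*Z.c1*W.c0 + X.c1*Z.c0*W.c0)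
      + D * (X.c0*Y.c0*W.c1 + X.c0*Y.c1*W.c0 + X.c1*Y.c0*W.c0) + E * (X.c0*Y.c0*Z.c1 + X.c0*Y.c1*Z.c0 + X.c1*Y.c0*Z.c0))
    (c0 := A * (Y.c0*Z.c0*W.c0) + B * (X.c0*Z.c0*W.c0)
      + D * (X.c0*Y.c0*W.c0) + E * (X.c0*Y.c0*Z.c0))
    (by simp [X2, X1, X0, Y2, Y1, Y0, Z2, Z1, Z0, W2, W1, W0, hA, hB, hD, hE])
    (by simp [X2, X1, X0, Y2, Y1, Y0, Z2, Z1, Z0, W2, W1, W0, hA, hB, hD, hE])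
    (by simp [X2, X1, X0, Y2, Y1, Y0, Z2, Z1, Z0, W2, W1, W0, hA, hB, hD, hE])
    (by simp [X2, X1, X0, Y2, Y1, Y0, Z2, Z1, Z0, W2, W1, W0, hA, hB, hD, hE])
    (by simp [X2, X1, X0, Y2, Y1, Y0, Z2, Z1, Z0, W2, W1, W0, hA, hB, hD, hE])
    (by simp [X2, X1, X0, Y2, Y1, Y0, Z2, Z1, Z0, W2, W1, W0, hA, hB, hD, hE])
    (by simp [X2, X1, X0, Y2, Y1, Y0, Z2, Z1, Z0, W2, W1, W0, hA, hB, hD, hE])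
    (by simp only [eval] at h; linear_combination h)
  refine ⟨_, l0, fun s t => Eq.trans ?_ (H s t)⟩
  simp only [eval, map, map_add, map_mul]
  ring

/-- If `A Y Z W + X (…)` vanishes at the conjugates of `τ` and at `(l0 : l1)`, then the resultant
with `X` computes the norm of `X(τ)`. -/
theorem norm_mul_eval_eq [CharP Ω 2] [IsAlgClosed Ω] (ι : F →+* Ω) {φ : F →+* F} {τ : F}
    {X Y Z W : BinQuad F} (hX : X.IsFixed φ) {A l1 l0 : F} {G : Ω → Ω → Ω}
    (H : ∀ s t : Ω, ι A * ((Y.map ι).eval s t * (Z.map ι).eval s t * (W.map ι).eval s t)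
      + (X.map ι).eval s t * G s t =
      (ι l1 * s + ι l0 * t) * ((s - ι τ * t) * (s - ι (φ τ) * t) * (s - ι (φ (φ τ)) * t)
        * (s - ι (φ (φ (φ τ))) * t) * (s - ι (φ (φ (φ (φ τ)))) * t))) :
    A ^ 2 * (X.res Y * X.res Z * X.res W) = X.eval l0 l1 * conjNorm φ (X.eval τ 1) := by
  apply ι.injective
  obtain ⟨a1, a0, b1, b0, hf⟩ := exists_linear_factors (X.map ι)
  have two : (2 : Ω) = 0 := CharTwo.two_eq_zero
  have ev : ∀ s, ι (X.eval s 1) = (a1 * ι s + a0) * (b1 * ι s + b0) := fun s => by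
    rw [← eval_map, hf, eval_factors, map_one]; ring
  have evl : ι (X.eval l0 l1) = (a1 * ι l0 + a0 * ι l1) * (b1 * ι l0 + b0 * ι l1) := by
    rw [← eval_map, hf, eval_factors]
  -- At either root of `X` only the term without `X` survives; the product of the two evaluations is
  -- the claim.
  have h1 := H a0 a1
  have h2 := H b0 b1
  have z1 : (X.map ι).eval a0 a1 = 0 := by
    rw [hf, eval_factors]; linear_combination (a1 * a0 * (b1 * a0 + b0 * a1)) * two
  have z2 : (X.map ι).eval b0 b1 = 0 := by
    rw [hf, eval_factors]; linear_combination (b1 * b0 * (a1 * b0 + a0 * b1)) * two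
  rw [z1, zero_mul, add_zero] at h1
  rw [z2, zero_mul, add_zero] at h2
  simp only [map_mul, map_pow, conjNorm, hX.apply_eval, ev, evl]
  rw [← res_map, ← res_map, ← res_map, hf, res_factors, res_factors, res_factors]
  have c1 : ∀ v, a0 - ι v * a1 = a1 * ι v + a0 := fun v => by
    rw [CharTwo.sub_eq_add]; ring
  have c2 : ∀ v, b0 - ι v * b1 = b1 * ι v + b0 := fun v => by
    rw [CharTwo.sub_eq_add]; ring
  have d1 : ι l1 * a0 + ι l0 * a1 = a1 * ι l0 + a0 * ι l1 := by ring
  have d2 : ι l1 * b0 + ι l0 * b1 = b1 * ι l0 + b0 * ι l1 := by ring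
  rw [d1] at h1
  rw [d2] at h2
  simp only [c1] at h1
  simp only [c2] at h2
  generalize (Y.map ι).eval a0 a1 = y1 at *
  generalize (Z.map ι).eval a0 a1 = z1' at *
  generalize (W.map ι).eval a0 a1 = w1 at *
  generalize (Y.map ι).eval b0 b1 = y2 at *
  generalize (Z.map ι).eval b0 b1 = z2' at *
  generalize (W.map ι).eval b0 b1 = w2 at *
  have e : ι A ^ 2 * (y1 * y2 * (z1' * z2') * (w1 * w2)) =
      (ι A * (y1 * z1' * w1)) * (ι A * (y2 * z2' * w2)) := by ring
  rw [e, h1, h2]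
  generalize a1 * ι l0 + a0 * ι l1 = u0
  generalize b1 * ι l0 + b0 * ι l1 = v0
  generalize φ τ = τ1
  generalize φ τ1 = τ2
  generalize φ τ2 = τ3
  generalize φ τ3 = τ4
  generalize a1 * ι τ + a0 = u1
  generalize a1 * ι τ1 + a0 = u2
  generalize a1 * ι τ2 + a0 = u3
  generalize a1 * ι τ3 + a0 = u4
  generalize a1 * ι τ4 + a0 = u5
  generalize b1 * ι τ + b0 = v1
  generalize b1 * ι τ1 + b0 = v2
  generalize b1 * ι τ2 + b0 = v3
  generalize b1 * ι τ3 + b0 = v4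
  generalize b1 * ι τ4 + b0 = v5
  ring

end CharTwo

end BinQuad

/-! ### Four points violating almost perfect nonlinearity, and their linear independence -/

section Configuration

variable {F : Type*} [Field F]

/-- Four distinct non-zero points with sum zero at which the squares `A² / x² = N(x) / x²` of the
values of the Dobbertin function also have sum zero. -/
structure VanishingQuadruple (φ : F →+* F) (x y z w A B D E : F) : Prop where
  x_ne : x ≠ 0
  y_ne : y ≠ 0
  z_ne : z ≠ 0
  w_ne : w ≠ 0
  sum_eq : x + y + z + w = 0
  A_fixed : φ A = A
  B_fixed : φ B = B
  D_fixed : φ D = D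
  E_fixed : φ E = E
  normA : A ^ 2 = conjNorm φ x
  normB : B ^ 2 = conjNorm φ y
  normD : D ^ 2 = conjNorm φ z
  normE : E ^ 2 = conjNorm φ w
  rel : A * (y * z * w) + B * (x * z * w) + D * (x * y * w) + E * (x * y * z) = 0
  xy_ne : x ≠ y
  xz_ne : x ≠ z
  xw_ne : x ≠ w

namespace VanishingQuadruple

variable [CharP F 2] {φ : F →+* F} {x y z w A B D E : F}

theorem swap_xy (h : VanishingQuadruple φ x y z w A B D E) :
    VanishingQuadruple φ y x z w B A D E where
  x_ne := h.y_ne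
  y_ne := h.x_ne
  z_ne := h.z_ne
  w_ne := h.w_ne
  sum_eq := by linear_combination h.sum_eq
  A_fixed := h.B_fixed
  B_fixed := h.A_fixed
  D_fixed := h.D_fixed
  E_fixed := h.E_fixed
  normA := h.normB
  normB := h.normA
  normD := h.normD
  normE := h.normE
  rel := by linear_combination h.rel
  xy_ne := h.xy_ne.symm
  xz_ne := fun e => h.xw_ne (by have := h.sum_eq; grind)
  xw_ne := fun e => h.xz_ne (by have := h.sum_eq; grind)

omit [CharP F 2] in
theorem swap_yz (h : VanishingQuadruple φ x y z w A B D E) :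
    VanishingQuadruple φ x z y w A D B E where
  x_ne := h.x_ne
  y_ne := h.z_ne
  z_ne := h.y_ne
  w_ne := h.w_ne
  sum_eq := by linear_combination h.sum_eq
  A_fixed := h.A_fixed
  B_fixed := h.D_fixed
  D_fixed := h.B_fixed
  E_fixed := h.E_fixed
  normA := h.normA
  normB := h.normD
  normD := h.normB
  normE := h.normE
  rel := by linear_combination h.rel
  xy_ne := h.xz_ne
  xz_ne := h.xy_ne
  xw_ne := h.xw_ne

omit [CharP F 2] in
theorem swap_zw (h : VanishingQuadruple φ x y z w A B D E) :
    VanishingQuadruple φ x y w z A B E D where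
  x_ne := h.x_ne
  y_ne := h.y_ne
  z_ne := h.w_ne
  w_ne := h.z_ne
  sum_eq := by linear_combination h.sum_eq
  A_fixed := h.A_fixed
  B_fixed := h.B_fixed
  D_fixed := h.E_fixed
  E_fixed := h.D_fixed
  normA := h.normA
  normB := h.normB
  normD := h.normE
  normE := h.normD
  rel := by linear_combination h.rel
  xy_ne := h.xy_ne
  xz_ne := h.xw_ne
  xw_ne := h.xz_ne

omit [CharP F 2] in
theorem A_ne (h : VanishingQuadruple φ x y z w A B D E) : A ≠ 0 := by
  rintro rfl
  exact conjNorm_ne_zero h.x_ne (φ := φ) (by rw [← h.normA]; ring)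

theorem B_ne (h : VanishingQuadruple φ x y z w A B D E) : B ≠ 0 := h.swap_xy.A_ne

theorem D_ne (h : VanishingQuadruple φ x y z w A B D E) : D ≠ 0 := h.swap_yz.B_ne

theorem E_ne (h : VanishingQuadruple φ x y z w A B D E) : E ≠ 0 := h.swap_zw.D_ne

theorem w_eq (h : VanishingQuadruple φ x y z w A B D E) : w = x + y + z := by
  have := h.sum_eq; grind

/-- For c in K, P(cx) = c³ P(x), so the relation reduces to 1 + a³ + b³ + (1 + a + b)³ = (a + 1)(b +
1)(a + b) = 0. -/
theorem not_all_ratios_fixed (h : VanishingQuadruple φ x y z w A B D E) {a b : F} (ha : φ a = a)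
    (hb : φ b = b) (hy : y = a * x) (hz : z = b * x) : False := by
  obtain rfl := h.w_eq
  have hx := h.x_ne
  have ha1 : a ≠ 1 := fun e => h.xy_ne (by rw [hy, e, one_mul])
  have hb1 : b ≠ 1 := fun e => h.xz_ne (by rw [hz, e, one_mul])
  have hab : a ≠ b := fun e => h.xw_ne (by rw [hy, hz, e]; grind)
  have ha0 : a ≠ 0 := by rintro rfl; exact h.y_ne (by rw [hy, zero_mul])
  have hb0 : b ≠ 0 := by rintro rfl; exact h.z_ne (by rw [hz, zero_mul])
  have hw : x + y + z = (1 + a + b) * x := by rw [hy, hz]; ring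
  have hc0 : 1 + a + b ≠ 0 := fun e => h.w_ne (by rw [hw, e, zero_mul])
  have hc : φ (1 + a + b) = 1 + a + b := by simp [ha, hb]
  have nA := h.normA
  have nB := h.normB
  have nD := h.normD
  have nE := h.normE
  have hr := h.rel
  rw [hw] at nE hr
  rw [hy] at nB hr
  rw [hz] at nD hr
  rw [conjNorm_mul, conjNorm_of_fixed ha, ← nA] at nB
  rw [conjNorm_mul, conjNorm_of_fixed hb, ← nA] at nD
  rw [conjNorm_mul, conjNorm_of_fixed hc, ← nA] at nE
  have hA := h.A_ne
  generalize hcc : 1 + a + b = c at *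
  have two : (2 : F) = 0 := CharTwo.two_eq_zero
  have key : A ^ 2 * x ^ 6 * (a * b * c) ^ 2 * (1 + a ^ 3 + b ^ 3 + c ^ 3) = 0 := by
    have sq : (A * (a * x * (b * x) * (c * x))) ^ 2 + (B * (x * (b * x) * (c * x))) ^ 2
        + (D * (x * (a * x) * (c * x))) ^ 2 + (E * (x * (a * x) * (b * x))) ^ 2 = 0 := by
      rw [← CharTwo.add_sq, ← CharTwo.add_sq, ← CharTwo.add_sq, hr]; ring
    simp only [mul_pow] at sq
    rw [nB, nD, nE] at sq
    linear_combination sq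
  have h3 : 1 + a ^ 3 + b ^ 3 + c ^ 3 = 0 := by
    have : A ^ 2 * x ^ 6 * (a * b * c) ^ 2 ≠ 0 := by positivity
    exact (mul_eq_zero.1 key).resolve_left this
  have h4 : (a - 1) * ((b - 1) * (a - b)) = 0 := by
    rw [← hcc] at h3; clear hcc; grind
  rcases mul_eq_zero.1 h4 with e | e
  · exact ha1 (sub_eq_zero.1 e)
  rcases mul_eq_zero.1 e with e | e
  · exact hb1 (sub_eq_zero.1 e)
  · exact hab (sub_eq_zero.1 e)

/-- If y/x = a is in K, then z/x is not, yet it satisfies a quadratic over K with constant term a D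
(1 + a) ≠ 0. -/
theorem ratio_not_fixed (h5 : ∀ x, φ (φ (φ (φ (φ x)))) = x)
    (h : VanishingQuadruple φ x y z w A B D E) : φ (y / x) ≠ y / x := by
  intro ha
  have hx := h.x_ne
  by_cases hb : φ (z / x) = z / x
  · exact h.not_all_ratios_fixed ha hb (by field_simp) (by field_simp)
  obtain rfl := h.w_eq
  have hr := h.rel
  obtain ⟨a, hy⟩ : ∃ a, a = y / x := ⟨_, rfl⟩
  obtain ⟨r, hz⟩ : ∃ r, r = z / x := ⟨_, rfl⟩
  rw [← hy] at ha
  rw [← hz] at hb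
  have hy : y = a * x := by rw [hy]; field_simp
  have hz : z = r * x := by rw [hz]; field_simp
  have ha1 : 1 + a ≠ 0 := fun e => h.xy_ne (by rw [hy]; grind)
  have ha0 : a ≠ 0 := by rintro rfl; exact h.y_ne (by rw [hy, zero_mul])
  have key : (A * a + B) * r ^ 2 + ((A * a + B) * (1 + a) + a * (D + E)) * r
      + a * D * (1 + a) = 0 := by
    rw [hy, hz] at hr
    refine (mul_eq_zero.1 ?_).resolve_left (pow_ne_zero 3 hx)
    linear_combination hr
  have := (coeff_eq_zero_of_quadratic h5 hb (by simp [ha, h.A_fixed, h.B_fixed])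
    (by simp [ha, h.A_fixed, h.B_fixed, h.D_fixed, h.E_fixed]) (by simp [ha, h.D_fixed]) key).2.2
  exact mul_ne_zero (mul_ne_zero ha0 h.D_ne) ha1 this

theorem ne_smul (h5 : ∀ x, φ (φ (φ (φ (φ x)))) = x)
    (h : VanishingQuadruple φ x y z w A B D E) {a b : F} (ha : φ a = a) (hb : φ b = b)
    (hab : a * x + b * y = 0) : a = 0 ∧ b = 0 := by
  have hx := h.x_ne
  have hb0 : b = 0 := by
    by_contra hb0
    refine h.ratio_not_fixed h5 ?_
    have : y / x = - a / b := by field_simp; linear_combination hab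
    rw [this]; simp [ha, hb]
  subst hb0
  simpa [hx] using hab

/-- If z = s x + t y, then y/x satisfies a cubic over K with constant term B s (1 + s). So s = 0 and
z = t y, or s = 1 and w = (1 + t) y; both contradict `ne_smul` for a permuted quadruple. -/
theorem linear_independent (h5 : ∀ x, φ (φ (φ (φ (φ x)))) = x)
    (h : VanishingQuadruple φ x y z w A B D E) {a b c : F} (ha : φ a = a) (hb : φ b = b)
    (hc : φ c = c) (habc : a * x + b * y + c * z = 0) : a = 0 ∧ b = 0 ∧ c = 0 := by
  by_cases hc0 : c = 0
  · subst hc0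
    have := h.ne_smul h5 ha hb (by linear_combination habc)
    simp [this]
  exfalso
  have hx := h.x_ne
  obtain ⟨s, t, hs, ht, hz⟩ : ∃ s t, φ s = s ∧ φ t = t ∧ z = s * x + t * y :=
    ⟨-a / c, -b / c, by simp [ha, hc], by simp [hb, hc], by
      field_simp; linear_combination habc⟩
  obtain rfl := h.w_eq
  have hr := h.rel
  have hτ := h.ratio_not_fixed h5
  obtain ⟨τ, hy⟩ : ∃ a, a = y / x := ⟨_, rfl⟩
  rw [← hy] at hτ
  have hy : y = τ * x := by rw [hy]; field_simp
  have key : (A * t * (1 + t)) * τ ^ 3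
      + (A * (s * (1 + t) + t * (1 + s)) + B * t * (1 + t) + D * (1 + t) + E * t) * τ ^ 2
      + (A * s * (1 + s) + B * (s * (1 + t) + t * (1 + s)) + D * (1 + s) + E * s) * τ
      + B * s * (1 + s) = 0 := by
    rw [hz, hy] at hr
    refine (mul_eq_zero.1 ?_).resolve_left (pow_ne_zero 3 hx)
    linear_combination hr
  have := (coeff_eq_zero_of_cubic h5 hτ (by simp [ht, h.A_fixed])
    (by simp [hs, ht, h.A_fixed, h.B_fixed, h.D_fixed, h.E_fixed])
    (by simp [hs, ht, h.A_fixed, h.B_fixed, h.D_fixed, h.E_fixed])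
    (by simp [hs, h.B_fixed]) key).2.2.2
  rcases mul_eq_zero.1 this with e | e
  · have hs0 := (mul_eq_zero.1 e).resolve_left h.B_ne
    subst hs0
    have := h.swap_xy.swap_yz.ne_smul h5 ht (b := 1) (map_one φ) (by rw [hz]; grind)
    exact one_ne_zero this.2
  · have := h.swap_xy.swap_yz.swap_zw.swap_yz.ne_smul h5 (a := 1 + t) (b := 1) (by simp [ht])
      (map_one φ) (by rw [hz]; grind)
    exact one_ne_zero this.2

end VanishingQuadruple

end Configuration

/-! ### Coefficient eliminations for a conic through a vertex -/

section NoCommonRoot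

variable {F : Type*} [Field F] [CharP F 2]

/-- A quintic that vanishes identically and has `z2 = z0 = 0`. -/
theorem quintic_ne_zero_of_middle {A B D E l1 l0 z1 : F}
    (hE : E ≠ 0) (hζ : z1 * l0 * l1 ≠ 0)
    (c4 : B * z1 * l1 + l1 * (D * l1) = 0)
    (c3 : A * (z1 * l1) + B * (z1 * (z1 + l0 + l1)) + l1 * (D * (z1 + l0 + l1) + E * z1)
      + l0 * (D * l1) = 0)
    (c1 : A * (z1 * l0) + l0 * (D * l0) = 0) : False := by
  have hl0 : l0 ≠ 0 := by rintro rfl; simp at hζ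
  have hl1 : l1 ≠ 0 := by rintro rfl; simp at hζ
  have hz1 : z1 ≠ 0 := by rintro rfl; simp at hζ
  have e1 : A * z1 = D * l0 := by
    refine mul_left_cancel₀ hl0 ?_; grind
  have e2 : B * z1 = D * l1 := by
    refine mul_left_cancel₀ hl1 ?_; grind
  have e3 : l1 * E * z1 = 0 := by grind
  simp [hl1, hE, hz1] at e3

theorem coeffs_eq_of_quintic_eq_zero {A B D E l1 l0 z1 : F} (hA : A ≠ 0)
    (hζ : l0 * l1 * (l0 + z1) ≠ 0)
    (c4 : B * (l1 * (z1 + l0 + l1)) + l1 * (E * l1) = 0)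
    (c2 : A * (l1 * l0 + z1 * (z1 + l0 + l1)) + B * (z1 * l0) + l1 * (D * l0)
      + l0 * (D * (z1 + l0 + l1) + E * z1) = 0)
    (c1 : A * (z1 * l0) + l0 * (D * l0) = 0)
    (cl : A * l1 + B * l0 = 0) : A = E ∧ B = D := by
  have hl0 : l0 ≠ 0 := by rintro rfl; simp at hζ
  have hl1 : l1 ≠ 0 := by rintro rfl; simp at hζ
  have hz : l0 + z1 ≠ 0 := by intro e; simp [e] at hζ
  have e1 : A * z1 = D * l0 := by
    refine mul_left_cancel₀ hl0 ?_; grind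
  have e2 : B * (z1 + l0 + l1) = E * l1 := by
    refine mul_left_cancel₀ hl1 ?_; grind
  have e3 : A * l1 = B * l0 := by grind
  have e4 : A * ((l0 + z1) * (l1 + z1)) * (l0 * l1) = 0 := by grind
  have e5 : z1 = l1 := by
    have : l1 + z1 = 0 := by simpa [hA, hl0, hl1, hz] using e4
    grind
  subst e5
  constructor
  · refine mul_left_cancel₀ hl1 ?_; grind
  · refine mul_left_cancel₀ hl0 ?_; grind

/-- Eliminating `Nt` and `Nl` leaves z0 l1 + z2 l0 + l0 l1 = 0 and z1 = l0 + l1 + z0 + z2. Then the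
form in `hζ` equals (l0 + l1)(z0 l1 + z2 l0 + l0 l1), hence vanishes. -/
theorem false_of_norm_relations {A B l1 l0 z2 z1 z0 n : F} (hA : A ≠ 0) (hB : B ≠ 0) (hn : n ≠ 0)
    {Nt Nl : F}
    (hζ : z2 * l0 ^ 2 + z1 * l0 * l1 + z0 * l1 ^ 2 ≠ 0)
    (hc : B * (z2 * (z2 + l1)) ≠ 0)
    (n1 : A ^ 2 = n * (Nt * Nl)) (n2 : B ^ 2 = n * Nl)
    (e1 : A * (z0 * (z0 + l0)) = B * (z2 * (z2 + l1)) * Nt)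
    (e2 : (A * l1 + B * l0) * (z2 * l0 ^ 2 + z1 * l0 * l1 + z0 * l1 ^ 2) ^ 2
      = B * (z2 * (z2 + l1)) * Nl)
    (e3 : (B * (z2 * (z2 + l1))) ^ 2
      = n * (z2 * l0 ^ 2 + z1 * l0 * l1 + z0 * l1 ^ 2) ^ 2 * (z0 * z2 * (z0 + z1 + z2)))
    (e4 : (B * (z2 * (z2 + l1))) ^ 2
      = n * (z2 * l0 ^ 2 + z1 * l0 * l1 + z0 * l1 ^ 2) ^ 2
        * ((z0 + l0) * (z2 + l1) * (z0 + z1 + z2))) : False := by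
  obtain ⟨ζ, hζd⟩ : ∃ ζ, ζ = z2 * l0 ^ 2 + z1 * l0 * l1 + z0 * l1 ^ 2 := ⟨_, rfl⟩
  obtain ⟨c, hcd⟩ : ∃ c, c = B * (z2 * (z2 + l1)) := ⟨_, rfl⟩
  rw [← hζd] at hζ e2 e3 e4
  rw [← hcd] at hc e1 e2 e3 e4
  have hS : z0 + z1 + z2 ≠ 0 := by
    intro e; rw [e] at e3; simp [hc] at e3
  have hR : z0 * z2 = (z0 + l0) * (z2 + l1) := by
    have : n * ζ ^ 2 * (z0 + z1 + z2) ≠ 0 := by simp [hn, hζ, hS]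
    refine mul_left_cancel₀ this ?_
    linear_combination e4 - e3
  have hz02 : z0 * z2 ≠ 0 := by
    intro e; rw [e] at e3; simp [hc] at e3
  have hNl : Nl ≠ 0 := by rintro rfl; simp [hB] at n2
  have hk : A * l1 + B * l0 ≠ 0 := by
    intro e; rw [e] at e2
    exact mul_ne_zero hc hNl (by rw [← e2]; ring)
  have fA : A * c ^ 2 = n * (z0 * (z0 + l0)) * ((A * l1 + B * l0) * ζ ^ 2) := by
    refine mul_left_cancel₀ hA ?_
    linear_combination c ^ 2 * n1 - n * c * Nl * e1 - n * A * (z0 * (z0 + l0)) * e2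
  have fB : B * c ^ 2 = n * (z2 * (z2 + l1)) * ((A * l1 + B * l0) * ζ ^ 2) := by
    linear_combination c * B * hcd + c * (z2 * (z2 + l1)) * n2 - n * (z2 * (z2 + l1)) * e2
  have fc : c ^ 2 = n * ζ ^ 2 * (z0 * (z0 + l0) * l1 + z2 * (z2 + l1) * l0) := by
    refine mul_left_cancel₀ hk ?_
    linear_combination l1 * fA + l0 * fB
  have g : z0 * (z0 + l0) * l1 + z2 * (z2 + l1) * l0 = z0 * z2 * (z0 + z1 + z2) := by
    have : n * ζ ^ 2 ≠ 0 := by simp [hn, hζ]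
    refine mul_left_cancel₀ this ?_
    rw [← fc, e3]
  have hR' : z0 * l1 + z2 * l0 + l0 * l1 = 0 := by grind
  have g' : z0 * z2 * (l0 + l1 + z0 + z1 + z2) = 0 := by grind
  have g1 : z1 = l0 + l1 + z0 + z2 := by
    have := (mul_eq_zero.1 g').resolve_left hz02
    grind
  apply hζ
  rw [hζd, g1]
  grind

end NoCommonRoot

/-! ### Exclusion of conics through a vertex -/

namespace VanishingQuadruple

variable {F : Type*} [Field F] [CharP F 2] {φ : F →+* F} {x y z w A B D E : F}

/-- The relation factors as (y + z)(A yz + B xw). Norms of A yz = B xw give A = B, and then yz = xw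
means (x + y)(x + z) = 0. -/
theorem not_A_eq_E_and_B_eq_D (h : VanishingQuadruple φ x y z w A B D E) :
    ¬ (A = E ∧ B = D) := by
  rintro ⟨hAE, hBD⟩
  have hr := h.rel
  have hw := h.w_eq
  have hA := h.A_ne
  have hB := h.B_ne
  have nA := h.normA
  have nB := h.normB
  have nD := h.normD
  have nE := h.normE
  rw [← hAE] at nE hr
  rw [← hBD] at nD hr
  have hyz : y + z ≠ 0 := fun e => h.xw_ne (by rw [hw]; grind)
  have e1 : A * (y * z) = B * (x * w) := by
    refine mul_left_cancel₀ hyz ?_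
    rw [hw] at hr ⊢; grind
  have e2 := congrArg (conjNorm φ) e1
  simp only [conjNorm_mul, conjNorm_of_fixed h.A_fixed, conjNorm_of_fixed h.B_fixed, ← nA, ← nB,
    ← nD, ← nE] at e2
  have e3 : A = B := by
    refine mul_left_cancel₀ (a := A ^ 4 * B ^ 4) (by simp [hA, hB]) ?_
    linear_combination e2
  rw [← e3] at e1
  have e4 := mul_left_cancel₀ hA e1
  have e5 : (x + y) * (x + z) = 0 := by rw [hw] at e4; grind
  rcases mul_eq_zero.1 e5 with e | e
  · exact h.xy_ne (CharTwo.add_eq_zero.1 e)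
  · exact h.xz_ne (CharTwo.add_eq_zero.1 e)

/-- The forms of x and y share the factor L = l1 τ + l0. Dividing the relation by L leaves a quintic
over K: it either vanishes identically, which is treated by cases, or is determined by the
conjugates of `τ`, which yields the norm relations. -/
theorem false_of_parametrization (h5 : ∀ x, φ (φ (φ (φ (φ x)))) = x)
    (h : VanishingQuadruple φ x y z w A B D E) {u τ l1 l0 z2 z1 z0 : F}
    (f1 : φ l1 = l1) (f0 : φ l0 = l0) (k2 : φ z2 = z2) (k1 : φ z1 = z1) (k0 : φ z0 = z0)
    (hx : x = u * (τ * (l1 * τ + l0))) (hy : y = u * (l1 * τ + l0))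
    (hz : z = u * (z2 * τ ^ 2 + z1 * τ + z0)) : False := by
  have hyne := h.y_ne
  have hu : u ≠ 0 := by rintro rfl; simp [hy] at hyne
  have hL : l1 * τ + l0 ≠ 0 := by intro e; simp [hy, e] at hyne
  have hτ : φ τ ≠ τ := by
    have := h.swap_xy.ratio_not_fixed h5
    have e : x / y = τ := by rw [hx, hy, mul_left_comm]; exact mul_div_cancel_right₀ _ (mul_ne_zero hu hL)
    rwa [e] at this
  have hw : w = u * ((z2 + l1) * τ ^ 2 + (z1 + l0 + l1) * τ + (z0 + l0)) := by
    rw [h.w_eq, hx, hy, hz]; ring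
  -- Otherwise L divides the form of z, and z is a K-combination of x and y.
  have hζ : z2 * l0 ^ 2 + z1 * l0 * l1 + z0 * l1 ^ 2 ≠ 0 := by
    intro e
    by_cases hl1 : l1 = 0
    · subst hl1
      have hl0 : l0 ≠ 0 := by rintro rfl; simp at hL
      have hz2 : z2 = 0 := by simpa [hl0] using e
      subst hz2
      have := h.linear_independent h5 (a := z1) (b := z0) (c := -l0) k1 k0 (by simp [f0])
        (by rw [hx, hy, hz]; ring)
      exact hl0 (by simpa using this.2.2)
    · have := h.linear_independent h5 (a := z2 * l1) (b := z1 * l1 + z2 * l0) (c := l1 ^ 2)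
        (by simp [k2, f1]) (by simp [k1, k2, f1, f0]) (by simp [f1])
        (by rw [hx, hy, hz]; grind)
      simp [hl1] at this
  obtain ⟨c5, d5⟩ : ∃ c, c = B * (z2 * (z2 + l1)) := ⟨_, rfl⟩
  obtain ⟨c4, d4⟩ : ∃ c, c = A * (z2 * (z2 + l1))
    + B * (z2 * (z1 + l0 + l1) + z1 * (z2 + l1)) + l1 * (D * (z2 + l1) + E * z2) := ⟨_, rfl⟩
  obtain ⟨c3, d3⟩ : ∃ c, c = A * (z2 * (z1 + l0 + l1) + z1 * (z2 + l1))
    + B * (z2 * (z0 + l0) + z1 * (z1 + l0 + l1) + z0 * (z2 + l1))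
    + l1 * (D * (z1 + l0 + l1) + E * z1) + l0 * (D * (z2 + l1) + E * z2) := ⟨_, rfl⟩
  obtain ⟨c2, d2⟩ : ∃ c, c = A * (z2 * (z0 + l0) + z1 * (z1 + l0 + l1) + z0 * (z2 + l1))
    + B * (z1 * (z0 + l0) + z0 * (z1 + l0 + l1))
    + l1 * (D * (z0 + l0) + E * z0) + l0 * (D * (z1 + l0 + l1) + E * z1) := ⟨_, rfl⟩
  obtain ⟨c1, d1⟩ : ∃ c, c = A * (z1 * (z0 + l0) + z0 * (z1 + l0 + l1))
    + B * (z0 * (z0 + l0)) + l0 * (D * (z0 + l0) + E * z0) := ⟨_, rfl⟩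
  obtain ⟨c0, d0⟩ : ∃ c, c = A * (z0 * (z0 + l0)) := ⟨_, rfl⟩
  have hrel : c5 * τ ^ 5 + c4 * τ ^ 4 + c3 * τ ^ 3 + c2 * τ ^ 2 + c1 * τ + c0 = 0 := by
    have hr := h.rel
    rw [hx, hy, hz, hw] at hr
    refine (mul_eq_zero.1 ?_).resolve_left (mul_ne_zero (pow_ne_zero 3 hu) hL)
    rw [d5, d4, d3, d2, d1, d0]
    linear_combination hr
  have hA := h.A_fixed
  have hB := h.B_fixed
  have hD := h.D_fixed
  have hE := h.E_fixed
  have g5 : φ c5 = c5 := by simp [d5, hB, k2, f1]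
  have g4 : φ c4 = c4 := by simp [d4, hA, hB, hD, hE, f1, f0, k2, k1]
  have g3 : φ c3 = c3 := by simp [d3, hA, hB, hD, hE, f1, f0, k2, k1, k0]
  have g2 : φ c2 = c2 := by simp [d2, hA, hB, hD, hE, f1, f0, k2, k1, k0]
  have g1 : φ c1 = c1 := by simp [d1, hA, hB, hD, hE, f1, f0, k1, k0]
  have g0 : φ c0 = c0 := by simp [d0, hA, f0, k0]
  -- At the root (l0 : l1) of L the terms with `D` and `E` drop out and the forms of z and w agree.
  have cl : c5 * l0 ^ 5 + c4 * l0 ^ 4 * l1 + c3 * l0 ^ 3 * l1 ^ 2 + c2 * l0 ^ 2 * l1 ^ 3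
      + c1 * l0 * l1 ^ 4 + c0 * l1 ^ 5
      = (A * l1 + B * l0) * (z2 * l0 ^ 2 + z1 * l0 * l1 + z0 * l1 ^ 2) ^ 2 := by
    rw [d5, d4, d3, d2, d1, d0]; grind
  by_cases hc : c5 = 0
  · rw [hc, zero_mul, zero_add] at hrel
    obtain ⟨n4, n3, n2, n1, n0⟩ := coeff_eq_zero_of_quartic h5 hτ g4 g3 g2 g1 g0 hrel
    have cl' : A * l1 + B * l0 = 0 := by
      rw [hc, n4, n3, n2, n1, n0] at cl
      refine (mul_eq_zero.1 (Eq.trans cl.symm ?_)).resolve_right (pow_ne_zero 2 hζ)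
      ring
    clear cl hrel g5 g4 g3 g2 g1 g0
    rw [n4] at d4
    rw [n3] at d3
    rw [n2] at d2
    rw [n1] at d1
    rw [n0] at d0
    rw [hc] at d5
    have e0 : z0 = 0 ∨ z0 = l0 := by
      rcases mul_eq_zero.1 ((mul_eq_zero.1 d0.symm).resolve_left h.A_ne) with e | e
      · exact Or.inl e
      · exact Or.inr (CharTwo.add_eq_zero.1 e)
    have e2 : z2 = 0 ∨ z2 = l1 := by
      rcases mul_eq_zero.1 ((mul_eq_zero.1 d5.symm).resolve_left h.B_ne) with e | e
      · exact Or.inl e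
      · exact Or.inr (CharTwo.add_eq_zero.1 e)
    have hw1 : z1 + l0 + l1 + l0 + l1 = z1 := by grind
    -- The outer cases make the form of z or of w a multiple of τ; the middle ones lead to A = E, B
    -- = D or to A = D, B = E.
    rcases e0 with rfl | rfl <;> rcases e2 with rfl | rfl
    · refine quintic_ne_zero_of_middle (A := A) (B := B) (D := D) (E := E) (l1 := l1) (l0 := l0)
        (z1 := z1) h.E_ne ?_ ?_ ?_ ?_
      · intro e; apply hζ; linear_combination e
      · linear_combination -d4
      · linear_combination -d3
      · linear_combination -d1
    · refine h.not_A_eq_E_and_B_eq_D (coeffs_eq_of_quintic_eq_zero (l1 := z2) (l0 := l0)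
        (z1 := z1) h.A_ne ?_ ?_ ?_ ?_ cl')
      · intro e; apply hζ; linear_combination e
      · grind
      · grind
      · grind
    · refine h.swap_zw.not_A_eq_E_and_B_eq_D (coeffs_eq_of_quintic_eq_zero (l1 := l1) (l0 := z0)
        (z1 := z1 + z0 + l1) h.A_ne ?_ ?_ ?_ ?_ cl')
      · intro e; apply hζ; grind
      · grind
      · grind
      · grind
    · refine quintic_ne_zero_of_middle (A := A) (B := B) (D := E) (E := D) (l1 := z2) (l0 := z0)
        (z1 := z1 + z0 + z2) h.D_ne ?_ ?_ ?_ ?_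
      · intro e; apply hζ; grind
      · grind
      · grind
      · grind
  let ι := algebraMap F (AlgebraicClosure F)
  have : CharP (AlgebraicClosure F) 2 := charP_of_injective_algebraMap ι.injective 2
  have H := quintic_factor ι h5 hτ g5 g4 g3 g2 g1 g0 hrel
  have E1 : c0 = c5 * conjNorm φ τ := by
    apply ι.injective
    have := H 0 1
    simp only [conjNorm, map_mul]
    simp only [CharTwo.sub_eq_add] at this
    linear_combination this
  have fL : ∀ v, φ (l1 * v + l0) = l1 * φ v + l0 := fun v => by simp [f1, f0]
  have E2 : (A * l1 + B * l0) * (z2 * l0 ^ 2 + z1 * l0 * l1 + z0 * l1 ^ 2) ^ 2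
      = c5 * conjNorm φ (l1 * τ + l0) := by
    rw [← cl]
    apply ι.injective
    have := H (ι l0) (ι l1)
    simp only [conjNorm, map_mul, fL, map_add, map_pow]
    simp only [CharTwo.sub_eq_add] at this
    rw [this]
    ring
  have nu : conjNorm φ u ≠ 0 := conjNorm_ne_zero hu
  have nx := h.normA
  have ny := h.normB
  have nz := h.normD
  have nw := h.normE
  rw [hx, conjNorm_mul, conjNorm_mul] at nx
  rw [hy, conjNorm_mul] at ny
  rw [hz, conjNorm_mul] at nz
  rw [hw, conjNorm_mul] at nw
  have hζW : (z2 + l1) * l0 ^ 2 + (z1 + l0 + l1) * l0 * l1 + (z0 + l0) * l1 ^ 2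
      = z2 * l0 ^ 2 + z1 * l0 * l1 + z0 * l1 ^ 2 := by grind
  -- The sextic is L times the quintic, so its extra linear factor is `c5` times L. The same
  -- identity for w is `E4`.
  have E3 := BinQuad.norm_mul_eval_eq (A := D) (X := ⟨z2, z1, z0⟩) (Y := ⟨l1, l0, 0⟩)
    (Z := ⟨0, l1, l0⟩) (W := ⟨z2 + l1, z1 + l0 + l1, z0 + l0⟩) ι (φ := φ) (τ := τ)
    (l1 := c5 * l1) (l0 := c5 * l0) ⟨k2, k1, k0⟩
    (G := fun s t => (ι l1 * s + ι l0 * t) * ((ι A * t + ι B * s)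
      * ((ι z2 + ι l1) * s ^ 2 + (ι z1 + ι l0 + ι l1) * s * t + (ι z0 + ι l0) * t ^ 2)
      + ι E * s * t * (ι l1 * s + ι l0 * t))) (fun s t => by
        have e : (ι (c5 * l1) * s + ι (c5 * l0) * t) = (ι l1 * s + ι l0 * t) * ι c5 := by
          simp only [map_mul]; ring
        rw [e, mul_assoc (ι l1 * s + ι l0 * t) (ι c5) _, ← H s t, d5, d4, d3, d2, d1, d0]
        simp only [BinQuad.map, BinQuad.eval, map_add, map_mul, map_zero]
        ring)
  have E4 := BinQuad.norm_mul_eval_eq (A := E) (X := ⟨z2 + l1, z1 + l0 + l1, z0 + l0⟩)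
    (Y := ⟨l1, l0, 0⟩) (Z := ⟨0, l1, l0⟩) (W := ⟨z2, z1, z0⟩) ι (φ := φ) (τ := τ)
    (l1 := c5 * l1) (l0 := c5 * l0) ⟨by simp [k2, f1], by simp [k1, f1, f0], by simp [k0, f0]⟩
    (G := fun s t => (ι l1 * s + ι l0 * t) * ((ι A * t + ι B * s)
      * (ι z2 * s ^ 2 + ι z1 * s * t + ι z0 * t ^ 2)
      + ι D * s * t * (ι l1 * s + ι l0 * t))) (fun s t => by
        have e : (ι (c5 * l1) * s + ι (c5 * l0) * t) = (ι l1 * s + ι l0 * t) * ι c5 := by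
          simp only [map_mul]; ring
        rw [e, mul_assoc (ι l1 * s + ι l0 * t) (ι c5) _, ← H s t, d5, d4, d3, d2, d1, d0]
        simp only [BinQuad.map, BinQuad.eval, map_add, map_mul, map_zero]
        ring)
  have r1 : ∀ a b c : F, (⟨a, b, c⟩ : BinQuad F).res ⟨l1, l0, 0⟩
      = c * (a * l0 ^ 2 + b * l0 * l1 + c * l1 ^ 2) := fun a b c => by
    simp only [BinQuad.res]; grind
  have r2 : ∀ a b c : F, (⟨a, b, c⟩ : BinQuad F).res ⟨0, l1, l0⟩
      = a * (a * l0 ^ 2 + b * l0 * l1 + c * l1 ^ 2) := fun a b c => by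
    simp only [BinQuad.res]; grind
  have r3 : (⟨z2, z1, z0⟩ : BinQuad F).res ⟨z2 + l1, z1 + l0 + l1, z0 + l0⟩
      = (z2 * l0 ^ 2 + z1 * l0 * l1 + z0 * l1 ^ 2) * (z0 + z1 + z2) := by
    simp only [BinQuad.res]; grind
  have r4 : ∀ a b c : F, (⟨a, b, c⟩ : BinQuad F).eval (c5 * l0) (c5 * l1)
      = c5 ^ 2 * (a * l0 ^ 2 + b * l0 * l1 + c * l1 ^ 2) := fun a b c => by
    simp only [BinQuad.eval]; ring
  have r5 : ∀ a b c : F, (⟨a, b, c⟩ : BinQuad F).eval τ 1 = a * τ ^ 2 + b * τ + c :=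
    fun a b c => by simp only [BinQuad.eval]; ring
  rw [r1, r2, r3, r4, r5] at E3
  rw [BinQuad.res_comm _ ⟨z2, z1, z0⟩, r1, r2, r3, r4, r5, hζW] at E4
  refine false_of_norm_relations h.A_ne h.B_ne nu hζ (by rwa [← d5]) nx ny
    (by rw [← d5, ← d0, E1]) (by rw [← d5, E2]) ?_ ?_
  · rw [← d5]
    have : (z2 * l0 ^ 2 + z1 * l0 * l1 + z0 * l1 ^ 2) * D ^ 2 ≠ 0 :=
      mul_ne_zero hζ (pow_ne_zero 2 h.D_ne)
    refine mul_left_cancel₀ this ?_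
    rw [nz]
    rw [nz] at E3
    linear_combination (-conjNorm φ u) * E3
  · rw [← d5]
    have : (z2 * l0 ^ 2 + z1 * l0 * l1 + z0 * l1 ^ 2) * E ^ 2 ≠ 0 :=
      mul_ne_zero hζ (pow_ne_zero 2 h.E_ne)
    refine mul_left_cancel₀ this ?_
    rw [nw]
    rw [nw] at E4
    linear_combination (-conjNorm φ u) * E4

/-- The six products of pairs of points are not related by a conic through one of the vertices. -/
theorem conic_coeffs_eq_zero (h5 : ∀ x, φ (φ (φ (φ (φ x)))) = x)
    (h : VanishingQuadruple φ x y z w A B D E) {p1 p2 p3 p4 p5 : F} (f1 : φ p1 = p1)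
    (f2 : φ p2 = p2) (f3 : φ p3 = p3) (f4 : φ p4 = p4) (f5 : φ p5 = p5)
    (hp : p1 * (x * y) + p2 * (x * z) + p3 * (x * w) + p4 * (y * z) + p5 * (y * w) = 0) :
    p1 = 0 ∧ p2 = 0 ∧ p3 = 0 ∧ p4 = 0 ∧ p5 = 0 := by
  have hyne := h.y_ne
  obtain ⟨τ, hτ⟩ : ∃ τ, τ = x / y := ⟨_, rfl⟩
  have hn := h.swap_xy.ratio_not_fixed h5
  rw [← hτ] at hn
  have hx : x = τ * y := by rw [hτ]; field_simp
  -- Without the product zw the relation is linear in z, so projecting from the vertex x = y = 0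
  -- parametrizes the conic.
  have hC : z * ((p2 + p3) * τ + (p4 + p5))
      = y * (p3 * τ ^ 2 + (p1 + p3 + p5) * τ + p5) := by
    refine mul_left_cancel₀ hyne ?_
    rw [h.w_eq, hx] at hp
    grind
  by_cases hL : (p2 + p3) * τ + (p4 + p5) = 0
  · rw [hL, mul_zero] at hC
    have q1 := coeff_eq_zero_of_quadratic h5 hn (map_zero φ) (by simp [f2, f3])
      (by simp [f4, f5]) ((by linear_combination hL) :
        0 * τ ^ 2 + (p2 + p3) * τ + (p4 + p5) = 0)
    have q2 := coeff_eq_zero_of_quadratic h5 hn f3 (by simp [f1, f3, f5]) f5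
      ((mul_eq_zero.1 hC.symm).resolve_left hyne)
    obtain ⟨-, a1, a2⟩ := q1
    obtain ⟨b1, b2, b3⟩ := q2
    rw [b1, add_zero] at a1
    rw [b3, add_zero] at a2
    rw [b1, b3, add_zero, add_zero] at b2
    exact ⟨b2, a1, b1, a2, b3⟩
  · exfalso
    refine h.false_of_parametrization h5 (u := y / ((p2 + p3) * τ + (p4 + p5))) (τ := τ)
      (l1 := p2 + p3) (l0 := p4 + p5) (z2 := p3) (z1 := p1 + p3 + p5) (z0 := p5)
      (by simp [f2, f3]) (by simp [f4, f5]) f3 (by simp [f1, f3, f5]) f5 ?_ ?_ ?_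
    · rw [hx, div_mul_eq_mul_div, eq_div_iff hL]; ring
    · rw [div_mul_cancel₀ _ hL]
    · rw [div_mul_eq_mul_div, eq_div_iff hL, hC]

end VanishingQuadruple

/-! ### Identities between the six resultants of four forms with sum zero -/

section ConicInvariants

variable {F : Type*} [Field F] [CharP F 2]

/-- With Q(v) = v1² + v2 v0, a resultant is Q of a cross product. The half-discriminant of Q on the
three cross products is the square of their determinant, and that determinant is det(X, Y, Z)². -/
theorem BinQuad.det_pow_four_eq (X Y Z W : BinQuad F) (hW : W = (X.add Y).add Z) :
    (X.c2 * (Y.c1 * Z.c0 + Y.c0 * Z.c1) + X.c1 * (Y.c2 * Z.c0 + Y.c0 * Z.c2)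
      + X.c0 * (Y.c2 * Z.c1 + Y.c1 * Z.c2)) ^ 4 =
    (Y.res Z * X.res W + X.res Z * Y.res W + X.res Y * Z.res W)
      * (X.res Y + X.res Z + X.res W + Y.res Z + Y.res W + Z.res W)
      + (X.res Y * X.res Z * X.res W + X.res Y * Y.res Z * Y.res W
        + X.res Z * Y.res Z * Z.res W + X.res W * Y.res W * Z.res W) := by
  obtain ⟨x2, x1, x0⟩ := X
  obtain ⟨y2, y1, y0⟩ := Y
  obtain ⟨z2, z1, z0⟩ := Z
  subst hW
  -- The polar form of Q on two cross products with a common factor.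
  have pol : ∀ a2 a1 a0 b2 b1 b0 c2 c1 c0 : F,
      (⟨a2, a1, a0⟩ : BinQuad F).res ⟨a2 + b2 + c2, a1 + b1 + c1, a0 + b0 + c0⟩
      + (⟨a2, a1, a0⟩ : BinQuad F).res ⟨b2, b1, b0⟩ + (⟨a2, a1, a0⟩ : BinQuad F).res ⟨c2, c1, c0⟩
      = (a2*b1+a1*b2)*(a1*c0+a0*c1)+(a2*c1+a1*c2)*(a1*b0+a0*b1) := by
    intros; simp only [BinQuad.res]; grind
  have adj : ∀ a2 a1 a0 b2 b1 b0 c2 c1 c0 : F,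
      (a1^2+a2*a0)*(b2*c0+b0*c2)^2+(b1^2+b2*b0)*(a2*c0+a0*c2)^2+(c1^2+c2*c0)*(b2*a0+b0*a2)^2
        +(b2*c0+b0*c2)*(a2*c0+a0*c2)*(b2*a0+b0*a2)
      = (a2*(b1*c0+b0*c1)+a1*(b2*c0+b0*c2)+a0*(b2*c1+b1*c2))^2 := by
    intros; grind
  have inv : ∀ a b c a' b' c' : F, (a*a'+b*b'+c*c')*(c+b+a'+a+b'+c')
      + (c*b*a'+c*a*b'+b*a*c'+a'*b'*c') =
      a*(a'+c+b)^2+b*(b'+c+a)^2+c*(c'+b+a)^2+(a'+c+b)*(b'+c+a)*(c'+b+a) := by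
    intros; grind
  have p1 := pol x2 x1 x0 y2 y1 y0 z2 z1 z0
  have p2 := pol y2 y1 y0 x2 x1 x0 z2 z1 z0
  have p3 := pol z2 z1 z0 x2 x1 x0 y2 y1 y0
  have s2 : (⟨y2 + x2 + z2, y1 + x1 + z1, y0 + x0 + z0⟩ : BinQuad F)
    = ⟨x2 + y2 + z2, x1 + y1 + z1, x0 + y0 + z0⟩ := by congr 1 <;> ring
  have s3 : (⟨z2 + x2 + y2, z1 + x1 + y1, z0 + x0 + y0⟩ : BinQuad F)
    = ⟨x2 + y2 + z2, x1 + y1 + z1, x0 + y0 + z0⟩ := by congr 1 <;> ring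
  rw [s2, BinQuad.res_comm _ ⟨x2, x1, x0⟩] at p2
  rw [s3, BinQuad.res_comm _ ⟨x2, x1, x0⟩, BinQuad.res_comm ⟨z2, z1, z0⟩ ⟨y2, y1, y0⟩] at p3
  simp only [BinQuad.add]
  rw [inv, p1, p2, p3]
  have q1 : (⟨y2, y1, y0⟩ : BinQuad F).res ⟨z2, z1, z0⟩
    = (y2*z0+y0*z2)^2 + (y2*z1+y1*z2)*(y1*z0+y0*z1) := rfl
  have q2 : (⟨x2, x1, x0⟩ : BinQuad F).res ⟨z2, z1, z0⟩
    = (x2*z0+x0*z2)^2 + (x2*z1+x1*z2)*(x1*z0+x0*z1) := rfl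
  have q3 : (⟨x2, x1, x0⟩ : BinQuad F).res ⟨y2, y1, y0⟩
    = (x2*y0+x0*y2)^2 + (x2*y1+x1*y2)*(x1*y0+x0*y1) := rfl
  rw [q1, q2, q3]
  have A := adj (y2*z1+y1*z2) (y2*z0+y0*z2) (y1*z0+y0*z1) (x2*z1+x1*z2) (x2*z0+x0*z2)
    (x1*z0+x0*z1) (x2*y1+x1*y2) (x2*y0+x0*y2) (x1*y0+x0*y1)
  have B : (y2*z1+y1*z2)*((x2*z0+x0*z2)*(x1*y0+x0*y1)+(x1*z0+x0*z1)*(x2*y0+x0*y2))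
      +(y2*z0+y0*z2)*((x2*z1+x1*z2)*(x1*y0+x0*y1)+(x1*z0+x0*z1)*(x2*y1+x1*y2))
      +(y1*z0+y0*z1)*((x2*z1+x1*z2)*(x2*y0+x0*y2)+(x2*z0+x0*z2)*(x2*y1+x1*y2))
      = (x2*(y1*z0+y0*z1)+x1*(y2*z0+y0*z2)+x0*(y2*z1+y1*z2))^2 := by grind
  rw [B] at A
  rw [show (x2*(y1*z0+y0*z1)+x1*(y2*z0+y0*z2)+x0*(y2*z1+y1*z2))^4
    = ((x2*(y1*z0+y0*z1)+x1*(y2*z0+y0*z2)+x0*(y2*z1+y1*z2))^2)^2 by ring, ← A]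
  ring

theorem BinQuad.res_conic_eq_zero (X Y Z W : BinQuad F) (hW : W = (X.add Y).add Z) (s t : F) :
    Z.res W * (X.eval s t * Y.eval s t) + Y.res W * (X.eval s t * Z.eval s t)
      + Y.res Z * (X.eval s t * W.eval s t) + X.res W * (Y.eval s t * Z.eval s t)
      + X.res Z * (Y.eval s t * W.eval s t) + X.res Y * (Z.eval s t * W.eval s t) = 0 := by
  subst hW
  simp only [BinQuad.res, BinQuad.eval, BinQuad.add]
  grind

end ConicInvariants

/-! ### Exclusion of a general conic -/

namespace VanishingQuadruple

variable {F : Type*} [Field F] [CharP F 2] {φ : F →+* F} {x y z w A B D E : F}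

/-- If the determinant is zero, eliminating between coefficients gives K-linear relations among x,
y, z whose coefficients are minors. Independence kills the minors of X, Y, then X itself. -/
theorem det_ne_zero (h5 : ∀ x, φ (φ (φ (φ (φ x)))) = x)
    (h : VanishingQuadruple φ x y z w A B D E) {X Y Z : BinQuad F} {u τ : F}
    (hX : X.IsFixed φ) (hY : Y.IsFixed φ) (hZ : Z.IsFixed φ)
    (hx : x = u * X.eval τ 1) (hy : y = u * Y.eval τ 1) (hz : z = u * Z.eval τ 1) :
    X.c2 * (Y.c1 * Z.c0 + Y.c0 * Z.c1) + X.c1 * (Y.c2 * Z.c0 + Y.c0 * Z.c2)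
      + X.c0 * (Y.c2 * Z.c1 + Y.c1 * Z.c2) ≠ 0 := by
  intro hd
  have hxne := h.x_ne
  obtain ⟨x2, x1, x0⟩ := X
  obtain ⟨y2, y1, y0⟩ := Y
  obtain ⟨z2, z1, z0⟩ := Z
  obtain ⟨X2, X1, X0⟩ := hX
  obtain ⟨Y2, Y1, Y0⟩ := hY
  obtain ⟨Z2, Z1, Z0⟩ := hZ
  simp only [BinQuad.eval] at *
  have k2 := (h.linear_independent h5 (a := y1 * z0 + y0 * z1) (b := x1 * z0 + x0 * z1)
    (c := x1 * y0 + x0 * y1) (by simp [*]) (by simp [*]) (by simp [*])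
    (by rw [hx, hy, hz]; grind)).2.2
  have k1 := (h.linear_independent h5 (a := y2 * z0 + y0 * z2) (b := x2 * z0 + x0 * z2)
    (c := x2 * y0 + x0 * y2) (by simp [*]) (by simp [*]) (by simp [*])
    (by rw [hx, hy, hz]; grind)).2.2
  have k0 := (h.linear_independent h5 (a := y2 * z1 + y1 * z2) (b := x2 * z1 + x1 * z2)
    (c := x2 * y1 + x1 * y2) (by simp [*]) (by simp [*]) (by simp [*])
    (by rw [hx, hy, hz]; grind)).2.2
  have m0 := (h.ne_smul h5 (a := y0) (b := x0) (by simp [*]) (by simp [*])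
    (by rw [hx, hy]; grind)).2
  have m1 := (h.ne_smul h5 (a := y1) (b := x1) (by simp [*]) (by simp [*])
    (by rw [hx, hy]; grind)).2
  have m2 := (h.ne_smul h5 (a := y2) (b := x2) (by simp [*]) (by simp [*])
    (by rw [hx, hy]; grind)).2
  exact hxne (by rw [hx, m0, m1, m2]; ring)

theorem false_of_conic_parametrization (h5 : ∀ x, φ (φ (φ (φ (φ x)))) = x)
    (h : VanishingQuadruple φ x y z w A B D E) {X Y Z : BinQuad F} {u τ : F} (hτ : φ τ ≠ τ)
    (hX : X.IsFixed φ) (hY : Y.IsFixed φ) (hZ : Z.IsFixed φ)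
    (hx : x = u * X.eval τ 1) (hy : y = u * Y.eval τ 1) (hz : z = u * Z.eval τ 1) : False := by
  have hdet := h.det_ne_zero h5 hX hY hZ hx hy hz
  obtain ⟨W, hW⟩ : ∃ W, W = (X.add Y).add Z := ⟨_, rfl⟩
  have hWf : W.IsFixed φ := by
    rw [hW]
    exact ⟨by simp [BinQuad.add, hX.1, hY.1, hZ.1], by simp [BinQuad.add, hX.2.1, hY.2.1, hZ.2.1],
      by simp [BinQuad.add, hX.2.2, hY.2.2, hZ.2.2]⟩
  have hWe : ∀ s t, W.eval s t = X.eval s t + Y.eval s t + Z.eval s t := fun s t => by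
    rw [hW]; simp only [BinQuad.eval, BinQuad.add]; ring
  have hw : w = u * W.eval τ 1 := by rw [h.w_eq, hx, hy, hz, hWe]; ring
  have hid := BinQuad.det_pow_four_eq X Y Z W hW
  have hcon := BinQuad.res_conic_eq_zero X Y Z W hW
  have hrel : Z.res W * (x * y) + Y.res W * (x * z) + Y.res Z * (x * w) + X.res W * (y * z)
      + X.res Z * (y * w) + X.res Y * (z * w) = 0 := by
    rw [hx, hy, hz, hw]; linear_combination u ^ 2 * hcon τ 1
  have hu : u ≠ 0 := by rintro rfl; exact h.x_ne (by rw [hx, zero_mul])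
  let ι := algebraMap F (AlgebraicClosure F)
  have : CharP (AlgebraicClosure F) 2 := charP_of_injective_algebraMap ι.injective 2
  obtain ⟨l1, l0, H⟩ := BinQuad.exists_cubic_factor ι h5 hτ hX hY hZ hWf h.A_fixed h.B_fixed
    h.D_fixed h.E_fixed (by
      have hr := h.rel
      rw [hx, hy, hz, hw] at hr
      refine (mul_eq_zero.1 ?_).resolve_left (pow_ne_zero 3 hu)
      linear_combination hr)
  have RX := BinQuad.norm_mul_eval_eq (A := A) (X := X) (Y := Y) (Z := Z) (W := W) ι hX
    (G := fun s t => ι B * ((Z.map ι).eval s t * (W.map ι).eval s t)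
      + ι D * ((Y.map ι).eval s t * (W.map ι).eval s t)
      + ι E * ((Y.map ι).eval s t * (Z.map ι).eval s t))
    (fun s t => Eq.trans (by ring) (H s t))
  have RY := BinQuad.norm_mul_eval_eq (A := B) (X := Y) (Y := X) (Z := Z) (W := W) ι hY
    (G := fun s t => ι A * ((Z.map ι).eval s t * (W.map ι).eval s t)
      + ι D * ((X.map ι).eval s t * (W.map ι).eval s t)
      + ι E * ((X.map ι).eval s t * (Z.map ι).eval s t))
    (fun s t => Eq.trans (by ring) (H s t))
  have RZ := BinQuad.norm_mul_eval_eq (A := D) (X := Z) (Y := X) (Z := Y) (W := W) ι hZ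
    (G := fun s t => ι A * ((Y.map ι).eval s t * (W.map ι).eval s t)
      + ι B * ((X.map ι).eval s t * (W.map ι).eval s t)
      + ι E * ((X.map ι).eval s t * (Y.map ι).eval s t))
    (fun s t => Eq.trans (by ring) (H s t))
  have RW := BinQuad.norm_mul_eval_eq (A := E) (X := W) (Y := X) (Z := Y) (W := Z) ι hWf
    (G := fun s t => ι A * ((Y.map ι).eval s t * (Z.map ι).eval s t)
      + ι B * ((X.map ι).eval s t * (Z.map ι).eval s t)
      + ι D * ((X.map ι).eval s t * (Y.map ι).eval s t))
    (fun s t => Eq.trans (by ring) (H s t))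
  clear H
  have hl := hcon l0 l1
  have hWl := hWe l0 l1
  rw [Y.res_comm X] at RY
  rw [Z.res_comm X, Z.res_comm Y] at RZ
  rw [W.res_comm X, W.res_comm Y, W.res_comm Z] at RW
  have fxy := hX.res hY
  have fxz := hX.res hZ
  have fxw := hX.res hWf
  have fyz := hY.res hZ
  have fyw := hY.res hWf
  have fzw := hZ.res hWf
  have nx := h.normA
  have ny := h.normB
  have nz := h.normD
  have nw := h.normE
  rw [hx, conjNorm_mul] at nx
  rw [hy, conjNorm_mul] at ny
  rw [hz, conjNorm_mul] at nz
  rw [hw, conjNorm_mul] at nw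
  clear hcon hWe hx hy hz hw
  generalize X.res Y = rxy at *
  generalize X.res Z = rxz at *
  generalize X.res W = rxw at *
  generalize Y.res Z = ryz at *
  generalize Y.res W = ryw at *
  generalize Z.res W = rzw at *
  have hd4 := pow_ne_zero 4 hdet
  rw [hid] at hd4
  clear hdet hid
  -- A vanishing resultant removes one product from the conic relation, so the other five vanish
  -- too. This contradicts the nonzero determinant here, and `h1` in the later cases.
  by_cases h1 : rxy = 0
  · obtain ⟨rfl, rfl, rfl, rfl, rfl⟩ := h.conic_coeffs_eq_zero h5 fzw fyw fyz fxw fxz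
      (by rw [h1] at hrel; linear_combination hrel)
    simp [h1] at hd4
  by_cases h2 : rxz = 0
  · obtain ⟨rfl, rfl, rfl, rfl, rfl⟩ := h.swap_yz.conic_coeffs_eq_zero h5 fyw fzw fyz fxw fxy
      (by rw [h2] at hrel; linear_combination hrel)
    simp at h1
  by_cases h3 : rxw = 0
  · obtain ⟨rfl, rfl, rfl, rfl, rfl⟩ := h.swap_zw.swap_yz.conic_coeffs_eq_zero h5 fyz fzw fyw fxz fxy
      (by rw [h3] at hrel; linear_combination hrel)
    simp at h1
  by_cases h4 : ryz = 0
  · obtain ⟨rfl, rfl, rfl, rfl, rfl⟩ := h.swap_xy.swap_yz.swap_xy.conic_coeffs_eq_zero h5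
      fxw fyw fxy fzw fxz
      (by rw [h4] at hrel; linear_combination hrel)
    simp at h1
  by_cases h6 : ryw = 0
  · obtain ⟨rfl, rfl, rfl, rfl, rfl⟩ := h.swap_zw.swap_xy.swap_yz.conic_coeffs_eq_zero h5
      fxz fzw fxw fyz fxy
      (by rw [h6] at hrel; linear_combination hrel)
    simp at h1
  by_cases h7 : rzw = 0
  · obtain ⟨rfl, rfl, rfl, rfl, rfl⟩ := h.swap_yz.swap_xy.swap_zw.swap_yz.conic_coeffs_eq_zero h5
      fxy fyw fxw fyz fxz
      (by rw [h7] at hrel; linear_combination hrel)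
    simp at h1
  have hn : conjNorm φ u ≠ 0 := conjNorm_ne_zero hu
  -- The unknown norm of X(τ) cancels, which leaves the value of X at (l0 : l1) in terms of
  -- resultants.
  have cancel : ∀ {A n N a v : F}, A ≠ 0 → A ^ 2 = n * N → A ^ 2 * a = v * N → v = n * a := by
    intro A n N a v hA hnN hv
    have hN : N ≠ 0 := by rintro rfl; simp [hA] at hnN
    refine mul_right_cancel₀ hN ?_
    rw [← hv, hnN]; ring
  have vx := cancel h.A_ne nx RX
  have vy := cancel h.B_ne ny RY
  have vz := cancel h.D_ne nz RZ
  have vw := cancel h.E_ne nw RW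
  rw [vx, vy, vz] at hWl
  rw [vw] at hWl
  rw [vx, vy, vz, vw] at hl
  have hs : rxy * rxz * rxw + rxy * ryz * ryw + rxz * ryz * rzw + rxw * ryw * rzw = 0 := by
    refine (mul_eq_zero.1 ?_).resolve_left hn
    have two : (2 : F) = 0 := CharTwo.two_eq_zero
    linear_combination hWl +
      (conjNorm φ u * (rxy * rxz * rxw + rxy * ryz * ryw + rxz * ryz * rzw)) * two
  -- Each conic term at (l0 : l1) is N(u)² times the product of all six resultants times one of
  -- them.
  have hsum : rxy + rxz + rxw + ryz + ryw + rzw = 0 := by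
    have : conjNorm φ u ^ 2 * (rxy * rxz * rxw * ryz * ryw * rzw) ≠ 0 := by
      simp [*]
    refine (mul_eq_zero.1 ?_).resolve_left this
    linear_combination hl
  rw [hs, hsum] at hd4
  simp at hd4

end VanishingQuadruple

/-! ### Parametrization of conics over the fixed field -/

namespace VanishingQuadruple

variable {F : Type*} [Field F] [CharP F 2] {φ : F →+* F}

theorem exists_fixed_sqrt (hsq : ∀ c : F, ∃ r, r ^ 2 = c) {c : F} (hc : φ c = c) :
    ∃ r, φ r = r ∧ r ^ 2 = c := by
  obtain ⟨r, hr⟩ := hsq c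
  refine ⟨r, ?_, hr⟩
  have : (φ r + r) ^ 2 = 0 := by
    rw [CharTwo.add_sq, ← map_pow, hr, hc, CharTwo.add_self_eq_zero]
  exact CharTwo.add_eq_zero.1 (pow_eq_zero_iff (two_ne_zero) |>.1 this)

/-- Three independent elements on a conic with a non-zero mixed term are the values of quadratic
polynomials at an element that is not fixed. -/
theorem exists_conic_parametrization_of_mixed (h5 : ∀ x, φ (φ (φ (φ (φ x)))) = x)
    (hsq : ∀ c : F, ∃ r, r ^ 2 = c) {x y z : F}
    (hind : ∀ a b c, φ a = a → φ b = b → φ c = c → a * x + b * y + c * z = 0 →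
      a = 0 ∧ b = 0 ∧ c = 0) {a b c f g k : F}
    (fa : φ a = a) (fb : φ b = b) (fc : φ c = c) (ff : φ f = f) (fg : φ g = g) (fk : φ k = k)
    (hk : k ≠ 0) (h : a * x ^ 2 + b * y ^ 2 + c * z ^ 2 + f * (y * z) + g * (x * z)
      + k * (x * y) = 0) :
    ∃ (u τ : F) (X Y Z : BinQuad F), φ τ ≠ τ ∧ X.IsFixed φ ∧ Y.IsFixed φ ∧ Z.IsFixed φ ∧
      x = u * X.eval τ 1 ∧ y = u * Y.eval τ 1 ∧ z = u * Z.eval τ 1 := by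
  obtain ⟨f', hf'⟩ : ∃ f', f' = f / k := ⟨_, rfl⟩
  obtain ⟨g', hg'⟩ : ∃ g', g' = g / k := ⟨_, rfl⟩
  have ff' : φ f' = f' := by simp [hf', ff, fk]
  have fg' : φ g' = g' := by simp [hg', fg, fk]
  have hf : f = f' * k := by rw [hf']; field_simp
  have hg : g = g' * k := by rw [hg']; field_simp
  obtain ⟨ra, fra, hra⟩ := exists_fixed_sqrt hsq fa
  obtain ⟨rb, frb, hrb⟩ := exists_fixed_sqrt hsq fb
  obtain ⟨rc, frc, hrc⟩ := exists_fixed_sqrt (φ := φ) hsq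
    (c := c + a * f' ^ 2 + b * g' ^ 2 + f' * g' * k) (by simp [fa, fb, fc, ff', fg', fk])
  -- Projection from the nucleus (f : g : k) removes the mixed terms with z; square roots turn the
  -- conic into (square of a linear form) = k u v.
  obtain ⟨u, hu⟩ : ∃ u, u = x + f' * z := ⟨_, rfl⟩
  obtain ⟨v, hv⟩ : ∃ v, v = y + g' * z := ⟨_, rfl⟩
  have hu0 : u ≠ 0 := by
    intro e
    exact one_ne_zero (hind 1 0 f' (map_one φ) (map_zero φ) ff' (by linear_combination e - hu)).1
  have hsqr : (ra * u + rb * v + rc * z) ^ 2 = k * (u * v) := by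
    rw [CharTwo.add_sq, CharTwo.add_sq, mul_pow, mul_pow, mul_pow, hra, hrb, hrc, hu, hv]
    rw [hf, hg] at h
    clear hra hrb hrc hf hg hf' hg' hu hv
    grind
  -- If `rc = 0`, then v/u, which is outside K by independence, satisfies a quadratic over K whose
  -- linear coefficient is k.
  by_cases hrc0 : rc = 0
  · exfalso
    have hτ : φ (v / u) ≠ v / u := by
      intro e
      refine one_ne_zero (hind (-(v / u)) 1 (g' - (v / u) * f') (by simpa using e) (map_one φ)
        (by rw [map_sub, map_mul, e, fg', ff']) ?_).2.1
      have : v / u * u = v := by field_simp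
      linear_combination (v / u) * hu - this - hv
    have := coeff_eq_zero_of_quadratic h5 hτ fb fk fa (by
      rw [hrc0, CharTwo.add_sq, CharTwo.add_sq, mul_pow, mul_pow, hra, hrb] at hsqr
      field_simp
      clear hτ hra hrb hrc hf hg hf' hg' hu hv
      grind)
    exact hk this.2.1
  · obtain ⟨τ, hτ⟩ : ∃ τ, τ = (ra * u + rb * v + rc * z) / u := ⟨_, rfl⟩
    have hτu : ra * u + rb * v + rc * z = τ * u := by rw [hτ]; field_simp
    have hv' : k * v = τ ^ 2 * u := by
      refine mul_left_cancel₀ hu0 ?_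
      rw [hτu] at hsqr
      linear_combination -hsqr
    have hvq : v = u * (τ ^ 2 / k) := by field_simp; linear_combination hv'
    obtain ⟨s2, hs2⟩ : ∃ s, s = rb / (k * rc) := ⟨_, rfl⟩
    obtain ⟨s1, hs1⟩ : ∃ s, s = 1 / rc := ⟨_, rfl⟩
    obtain ⟨s0, hs0⟩ : ∃ s, s = ra / rc := ⟨_, rfl⟩
    have fs2 : φ s2 = s2 := by simp [hs2, frb, fk, frc]
    have fs1 : φ s1 = s1 := by simp [hs1, frc]
    have fs0 : φ s0 = s0 := by simp [hs0, fra, frc]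
    have hz : z = u * (s2 * τ ^ 2 + s1 * τ + s0) := by
      refine mul_left_cancel₀ hrc0 ?_
      have e2 : rc * s2 = rb / k := by rw [hs2]; field_simp
      have e1 : rc * s1 = 1 := by rw [hs1]; field_simp
      have e0 : rc * s0 = ra := by rw [hs0]; field_simp
      have : rc * (u * (s2 * τ ^ 2 + s1 * τ + s0))
          = u * ((rc * s2) * τ ^ 2 + (rc * s1) * τ + rc * s0) := by ring
      rw [this, e2, e1, e0]
      have two : (2 : F) = 0 := CharTwo.two_eq_zero
      linear_combination hτu - rb * hvq - (ra * u + u * (rb / k * τ ^ 2)) * two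
    refine ⟨u, τ, ⟨f' * s2, f' * s1, 1 + f' * s0⟩, ⟨1 / k + g' * s2, g' * s1, g' * s0⟩,
      ⟨s2, s1, s0⟩, ?_, ⟨by simp [ff', fs2], by simp [ff', fs1], by simp [ff', fs0]⟩,
      ⟨by simp [fg', fs2, fk], by simp [fg', fs1], by simp [fg', fs0]⟩, ⟨fs2, fs1, fs0⟩,
      ?_, ?_, ?_⟩
    · intro e
      have H := hind (ra - τ) rb (rc + (ra - τ) * f' + rb * g') (by rw [map_sub, fra, e]) frb
        (by simp [frc, fra, e, ff', frb, fg'])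
        (by linear_combination hτu - (ra - τ) * hu - rb * hv)
      obtain ⟨e1, e2, e3⟩ := H
      rw [e1, e2] at e3
      exact hrc0 (by linear_combination e3)
    · have : x = u + f' * z := by rw [hu]; grind
      rw [this]
      simp only [BinQuad.eval]
      linear_combination f' * hz
    · have : y = v + g' * z := by rw [hv]; grind
      rw [this]
      simp only [BinQuad.eval]
      linear_combination hvq + g' * hz
    · simp only [BinQuad.eval]
      linear_combination hz

theorem exists_conic_parametrization (h5 : ∀ x, φ (φ (φ (φ (φ x)))) = x)
    (hsq : ∀ c : F, ∃ r, r ^ 2 = c) {x y z : F}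
    (hind : ∀ a b c, φ a = a → φ b = b → φ c = c → a * x + b * y + c * z = 0 →
      a = 0 ∧ b = 0 ∧ c = 0) {a b c f g k : F}
    (fa : φ a = a) (fb : φ b = b) (fc : φ c = c) (ff : φ f = f) (fg : φ g = g) (fk : φ k = k)
    (hne : ¬ (a = 0 ∧ b = 0 ∧ c = 0 ∧ f = 0 ∧ g = 0 ∧ k = 0))
    (h : a * x ^ 2 + b * y ^ 2 + c * z ^ 2 + f * (y * z) + g * (x * z)
      + k * (x * y) = 0) :
    ∃ (u τ : F) (X Y Z : BinQuad F), φ τ ≠ τ ∧ X.IsFixed φ ∧ Y.IsFixed φ ∧ Z.IsFixed φ ∧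
      x = u * X.eval τ 1 ∧ y = u * Y.eval τ 1 ∧ z = u * Z.eval τ 1 := by
  by_cases hk : k = 0
  · by_cases hg : g = 0
    · by_cases hf : f = 0
      -- A conic without mixed terms is the square of a linear form, against independence.
      · exfalso
        obtain ⟨ra, fra, hra⟩ := exists_fixed_sqrt hsq fa
        obtain ⟨rb, frb, hrb⟩ := exists_fixed_sqrt hsq fb
        obtain ⟨rc, frc, hrc⟩ := exists_fixed_sqrt hsq fc
        have : (ra * x + rb * y + rc * z) ^ 2 = 0 := by
          rw [CharTwo.add_sq, CharTwo.add_sq, mul_pow, mul_pow, mul_pow, hra, hrb, hrc]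
          rw [hk, hg, hf] at h
          linear_combination h
        obtain ⟨e1, e2, e3⟩ := hind ra rb rc fra frb frc (pow_eq_zero_iff two_ne_zero |>.1 this)
        refine hne ⟨?_, ?_, ?_, hf, hg, hk⟩
        · rw [← hra, e1]; ring
        · rw [← hrb, e2]; ring
        · rw [← hrc, e3]; ring
      · obtain ⟨u, τ, X, Y, Z, h1, h2, h3, h4, h6, h7, h8⟩ :=
          exists_conic_parametrization_of_mixed h5 hsq (x := y) (y := z) (z := x)
          (fun p q r hp hq hr e => by
            have := hind r p q hr hp hq (by linear_combination e); tauto)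
          fb fc fa fg fk ff hf (by linear_combination h)
        exact ⟨u, τ, Z, X, Y, h1, h4, h2, h3, h8, h6, h7⟩
    · obtain ⟨u, τ, X, Y, Z, h1, h2, h3, h4, h6, h7, h8⟩ :=
        exists_conic_parametrization_of_mixed h5 hsq (x := x) (y := z) (z := y)
          (fun p q r hp hq hr e => by
            have := hind p r q hp hr hq (by linear_combination e); tauto)
          fa fc fb ff fk fg hg (by linear_combination h)
      exact ⟨u, τ, X, Z, Y, h1, h2, h4, h3, h6, h8, h7⟩
  · exact exists_conic_parametrization_of_mixed h5 hsq hind fa fb fc ff fg fk hk h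

/-- There is no vanishing quadruple when `F` has dimension five over a perfect fixed field. -/
theorem elim (h5 : ∀ x, φ (φ (φ (φ (φ x)))) = x) (hsq : ∀ c : F, ∃ r, r ^ 2 = c)
    (hdep : ∀ v : Fin 6 → F, ∃ p : Fin 6 → F, (∀ i, φ (p i) = p i) ∧ p ≠ 0 ∧ ∑ i, p i * v i = 0)
    {x y z w A B D E : F} (h : VanishingQuadruple φ x y z w A B D E) : False := by
  obtain ⟨p, hp, hp0, hs⟩ := hdep ![x ^ 2, y ^ 2, z ^ 2, y * z, x * z, x * y]
  obtain ⟨u, τ, X, Y, Z, h1, h2, h3, h4, h6, h7, h8⟩ :=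
    exists_conic_parametrization h5 hsq (x := x) (y := y) (z := z)
      (fun a b c ha hb hc e => h.linear_independent h5 ha hb hc e)
      (hp 0) (hp 1) (hp 2) (hp 3) (hp 4) (hp 5)
      (fun ⟨e0, e1, e2, e3, e4, e5⟩ => hp0 (by
        funext i; fin_cases i <;> simp [e0, e1, e2, e3, e4, e5]))
      (by simpa [Fin.sum_univ_succ, add_assoc] using hs)
  exact h.false_of_conic_parametrization h5 h1 h2 h3 h4 h6 h7 h8

end VanishingQuadruple

/-! ### The Dobbertin function as norm divided by square -/

section DobbertinAbstract

variable {F : Type*} [Field F] [CharP F 2] {φ : F →+* F}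

omit [CharP F 2] in
theorem conjNorm_fixed (h5 : ∀ x, φ (φ (φ (φ (φ x)))) = x) (x : F) :
    φ (conjNorm φ x) = conjNorm φ x := by
  simp only [conjNorm, map_mul, h5]; ring

theorem fixed_of_sq_fixed {x : F} (h : φ (x ^ 2) = x ^ 2) : φ x = x := by
  rw [map_pow] at h
  have : (φ x + x) ^ 2 = 0 := by rw [CharTwo.add_sq, h, CharTwo.add_self_eq_zero]
  exact CharTwo.add_eq_zero.1 (pow_eq_zero_iff two_ne_zero |>.1 this)

/-- Three distinct non-zero points with sum zero do not have values with sum zero. -/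
theorem eq_of_three_values (h5 : ∀ x, φ (φ (φ (φ (φ x)))) = x) (hsq : ∀ c : F, ∃ r, r ^ 2 = c)
    {P : F → F} (hP : ∀ x, P x * x ^ 2 = conjNorm φ x) {y z : F} (hy : y ≠ 0) (hz : z ≠ 0)
    (h : P y + P z + P (y + z) = 0) : y = z := by
  by_contra hne
  have hw : y + z ≠ 0 := fun e => hne (CharTwo.add_eq_zero.1 e)
  obtain ⟨B, fB, hB⟩ := VanishingQuadruple.exists_fixed_sqrt hsq (conjNorm_fixed h5 y)
  obtain ⟨D, fD, hD⟩ := VanishingQuadruple.exists_fixed_sqrt hsq (conjNorm_fixed h5 z)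
  obtain ⟨E, fE, hE⟩ := VanishingQuadruple.exists_fixed_sqrt hsq (conjNorm_fixed h5 (y + z))
  have hr : B * (z * (y + z)) + D * (y * (y + z)) + E * (y * z) = 0 := by
    refine pow_eq_zero_iff two_ne_zero |>.1 ?_
    rw [CharTwo.add_sq, CharTwo.add_sq]
    simp only [mul_pow]
    rw [hB, hD, hE, ← hP, ← hP, ← hP]
    linear_combination (y ^ 2 * (z ^ 2 * (y + z) ^ 2)) * h
  obtain ⟨τ, hτ⟩ : ∃ τ, τ = z / y := ⟨_, rfl⟩
  have hzy : z = τ * y := by rw [hτ]; field_simp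
  have hD0 : D ≠ 0 := by
    rintro rfl
    exact conjNorm_ne_zero (φ := φ) hz (by rw [← hD]; ring)
  by_cases hf : φ τ = τ
  · have hBy := conjNorm_ne_zero (φ := φ) hy
    have e : conjNorm φ y * y ^ 4 * (τ ^ 2 * (1 + τ) ^ 2) * (1 + τ ^ 3 + (1 + τ) ^ 3) = 0 := by
      have hw' : y + z = (1 + τ) * y := by rw [hzy]; ring
      have h1 := hP y
      have h2 := hP z
      have h3 := hP (y + z)
      have c1 : φ (1 + τ) = 1 + τ := by simp [hf]
      rw [hw', conjNorm_mul, conjNorm_of_fixed c1] at h3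
      rw [hzy, conjNorm_mul, conjNorm_of_fixed hf] at h2
      rw [hw', hzy] at h
      linear_combination (y ^ 2 * (τ * y) ^ 2 * ((1 + τ) * y) ^ 2) * h
        - ((τ * y) ^ 2 * ((1 + τ) * y) ^ 2) * h1 - (y ^ 2 * ((1 + τ) * y) ^ 2) * h2
        - (y ^ 2 * (τ * y) ^ 2) * h3
    have hτ0 : τ ≠ 0 := by rintro rfl; simp [hzy] at hz
    have hτ1 : 1 + τ ≠ 0 := by
      intro e1; apply hw; rw [hzy]; linear_combination y * e1
    have e2 : 1 + τ ^ 3 + (1 + τ) ^ 3 = 0 := by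
      refine (mul_eq_zero.1 e).resolve_left ?_
      simp [hBy, hy, hτ0, hτ1]
    have e3 : τ * (1 + τ) = 0 := by clear hτ; grind
    exact mul_ne_zero hτ0 hτ1 e3
  -- Here z/y is outside K, so the constant coefficient `D` would have to be zero.
  · have := coeff_eq_zero_of_quadratic h5 hf (c2 := B) (c1 := B + D + E) (c0 := D) fB
      (by simp [fB, fD, fE]) fD (by
        rw [hzy] at hr
        refine (mul_eq_zero.1 ?_).resolve_left (pow_ne_zero 2 hy)
        linear_combination hr)
    exact hD0 this.2.2

theorem false_of_four_values (h5 : ∀ x, φ (φ (φ (φ (φ x)))) = x) (hsq : ∀ c : F, ∃ r, r ^ 2 = c)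
    (hdep : ∀ v : Fin 6 → F, ∃ p : Fin 6 → F, (∀ i, φ (p i) = p i) ∧ p ≠ 0 ∧ ∑ i, p i * v i = 0)
    {P : F → F} (hP : ∀ x, P x * x ^ 2 = conjNorm φ x) (hP0 : P 0 = 0) {x y z w : F}
    (hs : x + y + z + w = 0) (hxy : x ≠ y) (hxz : x ≠ z) (hxw : x ≠ w)
    (h : P x + P y + P z + P w = 0) : False := by
  have key : ∀ p q r : F, p ≠ 0 → q ≠ 0 → r ≠ 0 → p + q + r = 0 → P p + P q + P r ≠ 0 := by
    intro p q r hp hq hr hsum hval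
    have e : r = p + q := by grind
    rw [e] at hval
    have := eq_of_three_values h5 hsq hP hp hq hval
    exact hr (by rw [e, this, CharTwo.add_self_eq_zero])
  by_cases hx : x = 0
  · subst hx
    exact key y z w hxy.symm hxz.symm hxw.symm (by linear_combination hs)
      (by rw [hP0] at h; linear_combination h)
  by_cases hy : y = 0
  · subst hy
    exact key x z w hxy (fun e => hxw (by grind)) (fun e => hxz (by grind))
      (by linear_combination hs) (by rw [hP0] at h; linear_combination h)
  by_cases hz : z = 0
  · subst hz
    exact key x y w hx hy (fun e => hxy (by grind))
      (by linear_combination hs) (by rw [hP0] at h; linear_combination h)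
  by_cases hw : w = 0
  · subst hw
    exact key x y z hx hy hz
      (by linear_combination hs) (by rw [hP0] at h; linear_combination h)
  obtain ⟨A, fA, hA⟩ := VanishingQuadruple.exists_fixed_sqrt hsq (conjNorm_fixed h5 x)
  obtain ⟨B, fB, hB⟩ := VanishingQuadruple.exists_fixed_sqrt hsq (conjNorm_fixed h5 y)
  obtain ⟨D, fD, hD⟩ := VanishingQuadruple.exists_fixed_sqrt hsq (conjNorm_fixed h5 z)
  obtain ⟨E, fE, hE⟩ := VanishingQuadruple.exists_fixed_sqrt hsq (conjNorm_fixed h5 w)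
  have hr : A * (y * z * w) + B * (x * z * w) + D * (x * y * w) + E * (x * y * z) = 0 := by
    refine pow_eq_zero_iff two_ne_zero |>.1 ?_
    rw [CharTwo.add_sq, CharTwo.add_sq, CharTwo.add_sq]
    simp only [mul_pow]
    rw [hA, hB, hD, hE, ← hP, ← hP, ← hP, ← hP]
    linear_combination (x ^ 2 * y ^ 2 * z ^ 2 * w ^ 2) * h
  exact VanishingQuadruple.elim h5 hsq hdep
    ⟨hx, hy, hz, hw, hs, fA, fB, fD, fE, hA, hB, hD, hE, hr, hxy, hxz, hxw⟩

/-- The Dobbertin function is almost perfect nonlinear. -/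
theorem dobbertin_apn (h5 : ∀ x, φ (φ (φ (φ (φ x)))) = x) (hsq : ∀ c : F, ∃ r, r ^ 2 = c)
    (hdep : ∀ v : Fin 6 → F, ∃ p : Fin 6 → F, (∀ i, φ (p i) = p i) ∧ p ≠ 0 ∧ ∑ i, p i * v i = 0)
    {P : F → F} (hP : ∀ x, P x * x ^ 2 = conjNorm φ x) (hP0 : P 0 = 0) {x y a : F} (ha : a ≠ 0)
    (h : P (x + a) + P x = P (y + a) + P y) : y = x ∨ y = x + a := by
  by_contra! hne
  obtain ⟨h1, h2⟩ := hne
  refine false_of_four_values h5 hsq hdep hP hP0 (x := x) (y := x + a) (z := y) (w := y + a)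
    (by grind) (by simpa using ha) h1.symm (fun e => h2 (by rw [e]; grind)) (by grind)

/-- Two values of the Dobbertin function on a coset of the fixed field that is not the fixed field
itself never differ by an element of the fixed field. -/
theorem eq_of_add_fixed (h5 : ∀ x, φ (φ (φ (φ (φ x)))) = x)
    {P : F → F} (hP : ∀ x, P x * x ^ 2 = conjNorm φ x) {y e c : F} (hy : φ y ≠ y) (he : φ e = e)
    (hc : φ c = c) (h : P y + P (y + e) = c) : e = 0 := by
  by_contra he0
  have hy0 : y ≠ 0 := by rintro rfl; simp at hy
  have hye : y + e ≠ 0 := fun h0 => hy (by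
    have : y = e := CharTwo.add_eq_zero.1 h0
    rw [this, he])
  have ht : φ (y ^ 2) ≠ y ^ 2 := fun h0 => hy (fixed_of_sq_fixed h0)
  have f1 := conjNorm_fixed h5 y
  have f2 := conjNorm_fixed h5 (y + e)
  -- Clearing denominators gives a quadratic over K in y², with constant term N(y) e².
  have := coeff_eq_zero_of_quadratic h5 ht (c2 := c)
    (c1 := c * e ^ 2 + conjNorm φ y + conjNorm φ (y + e)) (c0 := conjNorm φ y * e ^ 2) hc
    (by simp [hc, he, f1, f2]) (by simp [f1, he]) (by
      have h1 := hP y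
      have h2 := hP (y + e)
      rw [CharTwo.add_sq] at h2
      grind)
  exact mul_ne_zero (conjNorm_ne_zero hy0) (pow_ne_zero 2 he0) this.2.2

/-- The Dobbertin function is injective if cubing is injective on the fixed field. -/
theorem dobbertin_injective (h5 : ∀ x, φ (φ (φ (φ (φ x)))) = x)
    (hcube : ∀ a b, φ a = a → φ b = b → a ^ 3 = b ^ 3 → a = b)
    {P : F → F} (hP : ∀ x, P x * x ^ 2 = conjNorm φ x) (hP0 : P 0 = 0) :
    Function.Injective P := by
  have hne : ∀ x, x ≠ 0 → P x ≠ 0 := fun x hx e =>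
    conjNorm_ne_zero (φ := φ) hx (by rw [← hP, e, zero_mul])
  have hnorm : ∀ x, x ≠ 0 → conjNorm φ (P x) = conjNorm φ x ^ 3 := by
    intro x hx
    have h1 := congrArg (conjNorm φ) (hP x)
    rw [pow_two, conjNorm_mul, conjNorm_mul, conjNorm_of_fixed (conjNorm_fixed h5 x)] at h1
    refine mul_right_cancel₀ (pow_ne_zero 2 (conjNorm_ne_zero (φ := φ) hx)) ?_
    linear_combination h1
  intro x y h
  by_cases hx : x = 0
  · by_contra hxy
    exact hne y (fun e => hxy (by rw [hx, e])) (by rw [← h, hx, hP0])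
  by_cases hy : y = 0
  · exact (hne x hx (by rw [h, hy, hP0])).elim
  have hN : conjNorm φ x = conjNorm φ y :=
    hcube _ _ (conjNorm_fixed h5 x) (conjNorm_fixed h5 y) (by rw [← hnorm x hx, ← hnorm y hy, h])
  have h2 : x ^ 2 = y ^ 2 := by
    refine mul_left_cancel₀ (hne x hx) ?_
    rw [hP, h, hP, hN]
  have : (x + y) ^ 2 = 0 := by rw [CharTwo.add_sq, h2, CharTwo.add_self_eq_zero]
  exact CharTwo.add_eq_zero.1 (pow_eq_zero_iff two_ne_zero |>.1 this)

theorem fixed_of_value_fixed (h5 : ∀ x, φ (φ (φ (φ (φ x)))) = x)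
    {P : F → F} (hP : ∀ x, P x * x ^ 2 = conjNorm φ x) {y : F} (h : φ (P y) = P y) :
    φ y = y := by
  by_cases hy : y = 0
  · rw [hy, map_zero]
  have hne : P y ≠ 0 := fun e => conjNorm_ne_zero (φ := φ) hy (by rw [← hP, e, zero_mul])
  refine fixed_of_sq_fixed ?_
  have : y ^ 2 = conjNorm φ y / P y := by rw [← hP]; field_simp
  rw [this, map_div₀, conjNorm_fixed h5, h]

end DobbertinAbstract

/-! ### Almost perfect nonlinearity of x^(2^m - 1) on the subfield -/

section PowerMap

variable {K : Type*} [Field K] [CharP K 2] {σ : K →+* K}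

/-- A linearized equation of degree four has, besides `0` and `1`, at most two roots of the
form `s`, `s + 1`. -/
theorem eq_or_eq_add_one_of_quartic {A B s t : K} (hA : A ≠ 0) (hs0 : s ≠ 0) (hs1 : s ≠ 1)
    (ht0 : t ≠ 0) (ht1 : t ≠ 1) (hs : A * (s ^ 4 + s) + B * (s ^ 2 + s) = 0)
    (ht : A * (t ^ 4 + t) + B * (t ^ 2 + t) = 0) : t = s ∨ t = s + 1 := by
  have key : ∀ v : K, v ≠ 0 → v ≠ 1 → A * (v ^ 4 + v) + B * (v ^ 2 + v) = 0 →
      A * (v ^ 2 + v + 1) + B = 0 := by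
    intro v h0 h1 hv
    have h1' : v + 1 ≠ 0 := fun e => h1 (CharTwo.add_eq_zero.1 e)
    refine (mul_eq_zero.1 ?_).resolve_left (mul_ne_zero h0 h1')
    grind
  have h1 := key s hs0 hs1 hs
  have h2 := key t ht0 ht1 ht
  have h3 : (t + s) * (t + (s + 1)) = 0 := by
    refine (mul_eq_zero.1 ?_).resolve_left hA
    grind
  rcases mul_eq_zero.1 h3 with e | e
  · exact Or.inl (CharTwo.add_eq_zero.1 e)
  · exact Or.inr (CharTwo.add_eq_zero.1 e)

/-- If the equation `σ s = b s² + (b + 1) s` implies a linearized quartic equation, then the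
function `x ↦ σ x / x` is almost perfect nonlinear in the direction `1`. -/
theorem apn_one_of_quartic {p : K → K} (hp : ∀ x, p x * x = σ x) (hp0 : p 0 = 0)
    (h0 : ∀ s, σ s = s → s = 0 ∨ s = 1) (h1 : ∀ s, σ s = s ^ 2 → s = 0 ∨ s = 1)
    (hq : ∀ b : K, b ≠ 0 → ∃ A B : K, A ≠ 0 ∧
      ∀ s, σ s = b * s ^ 2 + (b + 1) * s → A * (s ^ 4 + s) + B * (s ^ 2 + s) = 0)
    {s t : K} (h : p (s + 1) + p s = p (t + 1) + p t) : t = s ∨ t = s + 1 := by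
  have hp1 : p 1 = 1 := by simpa using hp 1
  have hlin : ∀ v : K, v ≠ 0 → v ≠ 1 → σ v = (p (v + 1) + p v) * v ^ 2
      + (p (v + 1) + p v + 1) * v := by
    intro v _ _
    have e1 := hp v
    have e2 := hp (v + 1)
    rw [map_add, map_one] at e2
    grind
  have hone : ∀ v : K, p (v + 1) + p v = 1 → v = 0 ∨ v = 1 := by
    intro v hv
    by_contra! hne
    have e := hlin v hne.1 hne.2
    rw [hv] at e
    rcases h1 v (by rw [e]; grind) with e | e
    · exact hne.1 e
    · exact hne.2 e
  have two_elts : (s = 0 ∨ s = 1) → (t = 0 ∨ t = 1) → t = s ∨ t = s + 1 := by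
    rintro (rfl | rfl) (rfl | rfl)
    · simp
    · simp
    · right; exact (CharTwo.add_self_eq_zero 1).symm
    · simp
  have val : ∀ v : K, v = 0 ∨ v = 1 → p (v + 1) + p v = 1 := by
    rintro v (rfl | rfl)
    · simp [hp0, hp1]
    · simp [CharTwo.add_self_eq_zero, hp0, hp1]
  by_cases hs : s = 0 ∨ s = 1
  · exact two_elts hs (hone t (by rw [← h]; exact val s hs))
  by_cases ht : t = 0 ∨ t = 1
  · exact two_elts (hone s (by rw [h]; exact val t ht)) ht
  push Not at hs ht
  have es := hlin s hs.1 hs.2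
  have et := hlin t ht.1 ht.2
  rw [← h] at et
  by_cases hb : p (s + 1) + p s = 0
  · rw [hb] at es
    rcases h0 s (by rw [es]; ring) with e | e
    · exact (hs.1 e).elim
    · exact (hs.2 e).elim
  obtain ⟨A, B, hA, H⟩ := hq _ hb
  exact eq_or_eq_add_one_of_quartic hA hs.1 hs.2 ht.1 ht.2 (H s es) (H t et)

end PowerMap

section FiniteFieldPower

variable {K : Type*} [Field K] [CharP K 2]

theorem eq_zero_or_one_of_pow_eq {i j : ℕ} (hij : Nat.Coprime i j) {x : K}
    (hi : x ^ 2 ^ i = x) (hj : x ^ 2 ^ j = x) : x = 0 ∨ x = 1 := by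
  have h1 : Function.IsPeriodicPt (frobenius K 2) i x := by
    rw [Function.IsPeriodicPt, Function.IsFixedPt, iterate_frobenius, hi]
  have h2 : Function.IsPeriodicPt (frobenius K 2) j x := by
    rw [Function.IsPeriodicPt, Function.IsFixedPt, iterate_frobenius, hj]
  have h3 := h1.gcd h2
  rw [hij] at h3
  have h4 : x ^ 2 = x := h3
  have h5 : x * (x - 1) = 0 := by linear_combination h4
  rcases mul_eq_zero.1 h5 with e | e
  · exact Or.inl e
  · exact Or.inr (sub_eq_zero.1 e)

/-- Coprimality of m gives injectivity and excludes derivative value 0 off {0, 1}; that of m - 1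
excludes derivative value 1 there. -/
theorem coprime_of_exponent {k m : ℕ} (hk : Odd k) (hm : m = k - 1 ∨ m = (k + 1) / 2 ∨ m = 2)
    (hm0 : 0 < m) : Nat.Coprime m k ∧ Nat.Coprime (m - 1) k := by
  obtain ⟨j, rfl⟩ := hk
  rcases hm with rfl | rfl | rfl
  · obtain ⟨i, rfl⟩ : ∃ i, j = i + 1 := ⟨j - 1, by omega⟩
    constructor
    · refine Nat.isCoprime_iff_coprime.1 ⟨-1, 1, ?_⟩
      push_cast [Nat.add_sub_cancel]
      ring
    · rw [show 2 * (i + 1) + 1 - 1 - 1 = 2 * i + 1 by omega]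
      refine Nat.isCoprime_iff_coprime.1 ⟨i + 1, -i, ?_⟩
      push_cast
      ring
  · rw [show (2 * j + 1 + 1) / 2 = j + 1 by omega]
    constructor
    · refine Nat.isCoprime_iff_coprime.1 ⟨2, -1, ?_⟩
      push_cast
      ring
    · refine Nat.isCoprime_iff_coprime.1 ⟨-2, 1, ?_⟩
      push_cast [Nat.add_sub_cancel]
      ring
  · constructor
    · refine Nat.isCoprime_iff_coprime.1 ⟨-j, 1, ?_⟩
      push_cast
      ring
    · simp

omit [CharP K 2] in
theorem pow_two_pow_sub_one_mul_self (m : ℕ) (x : K) : x ^ (2 ^ m - 1) * x = x ^ 2 ^ m := by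
  rw [← pow_succ, Nat.sub_add_cancel Nat.one_le_two_pow]

/-- On solutions of `x^(2^m) = b x² + (b + 1) x` with `b ≠ 0` a linearized quartic vanishes. -/
theorem exists_quartic {k m : ℕ} (hk : Odd k) (hm : m = k - 1 ∨ m = (k + 1) / 2 ∨ m = 2)
    (hm0 : 0 < m) (hq : ∀ x : K, x ^ 2 ^ k = x) {b : K} (hb : b ≠ 0) :
    ∃ A B : K, A ≠ 0 ∧ ∀ s : K, s ^ 2 ^ m = b * s ^ 2 + (b + 1) * s →
      A * (s ^ 4 + s) + B * (s ^ 2 + s) = 0 := by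
  rcases hm with rfl | rfl | rfl
  · refine ⟨b ^ 2, b ^ 2 + 1, pow_ne_zero 2 hb, fun s hs => ?_⟩
    -- For m = k - 1 the power map inverts squaring; for m = (k + 1)/2 its square is squaring; for m
    -- = 2 the equation is itself quartic.
    have h1 : (s ^ 2 ^ (k - 1)) ^ 2 = s := by
      rw [← pow_mul, ← pow_succ, Nat.sub_add_cancel (by omega), hq]
    rw [hs, CharTwo.add_sq] at h1
    grind
  · obtain ⟨j, rfl⟩ := hk
    rw [show (2 * j + 1 + 1) / 2 = j + 1 by omega]
    obtain ⟨σ, hσ⟩ : ∃ σ : K →+* K, ∀ x, σ x = x ^ 2 ^ (j + 1) :=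
      ⟨iterateFrobenius K 2 (j + 1), fun x => iterateFrobenius_def 2 (j + 1) x⟩
    refine ⟨σ b * b ^ 2, σ b * (b ^ 2 + 1) + (σ b + 1) * b + 1,
      mul_ne_zero (by simpa using hb) (pow_ne_zero 2 hb), fun s hs => ?_⟩
    rw [← hσ] at hs
    have h1 : σ (σ s) = s ^ 2 := by
      rw [hσ, hσ, ← pow_mul, ← pow_add, show j + 1 + (j + 1) = 2 * j + 1 + 1 by ring, pow_succ,
        pow_mul, hq]
    have h2 := congrArg σ hs
    rw [h1, map_add, map_mul, map_mul, map_add, map_one, map_pow, hs] at h2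
    rw [CharTwo.add_sq] at h2
    grind
  · refine ⟨1, b, one_ne_zero, fun s hs => ?_⟩
    norm_num at hs
    rw [hs]
    grind

/-- The power function with exponent `2 ^ m - 1` is almost perfect nonlinear. -/
theorem pow_two_pow_sub_one_apn {k m : ℕ} (hk : Odd k)
    (hm : m = k - 1 ∨ m = (k + 1) / 2 ∨ m = 2) (hm0 : 0 < m) (hq : ∀ x : K, x ^ 2 ^ k = x)
    {x y a : K} (ha : a ≠ 0)
    (h : (x + a) ^ (2 ^ m - 1) + x ^ (2 ^ m - 1) = (y + a) ^ (2 ^ m - 1) + y ^ (2 ^ m - 1)) :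
    y = x ∨ y = x + a := by
  obtain ⟨c1, c2⟩ := coprime_of_exponent hk hm hm0
  have he : 2 ^ m - 1 ≠ 0 := by
    have := Nat.one_lt_two_pow hm0.ne'
    omega
  obtain ⟨s, rfl⟩ : ∃ s, x = s * a := ⟨x / a, by field_simp⟩
  obtain ⟨t, rfl⟩ : ∃ t, y = t * a := ⟨y / a, by field_simp⟩
  have e : ∀ v : K, v * a + a = (v + 1) * a := fun v => by ring
  rw [e, e] at h
  simp only [mul_pow, ← add_mul] at h
  have h := mul_right_cancel₀ (pow_ne_zero _ ha) h
  have := apn_one_of_quartic (σ := iterateFrobenius K 2 m) (p := fun x => x ^ (2 ^ m - 1))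
    (fun x => pow_two_pow_sub_one_mul_self m x) (zero_pow he)
    (fun s hs => eq_zero_or_one_of_pow_eq c1 hs (hq s))
    (fun s hs => by
      refine eq_zero_or_one_of_pow_eq c2 ?_ (hq s)
      apply CharTwo.sq_injective
      have hs : s ^ 2 ^ m = s ^ 2 := hs
      change (s ^ 2 ^ (m - 1)) ^ 2 = s ^ 2
      rw [← pow_mul, ← pow_succ, Nat.sub_add_cancel hm0, hs])
    (fun b hb => exists_quartic hk hm hm0 hq hb) h
  rcases this with e | e
  · left; rw [e]
  · right; rw [e]; ring

theorem pow_two_pow_sub_one_injective {k m : ℕ} (hmk : Nat.Coprime m k) (hm0 : 0 < m)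
    (hq : ∀ x : K, x ^ 2 ^ k = x) : Function.Injective fun x : K => x ^ (2 ^ m - 1) := by
  have he : 2 ^ m - 1 ≠ 0 := by
    have := Nat.one_lt_two_pow hm0.ne'
    omega
  intro x y h
  have h : x ^ (2 ^ m - 1) = y ^ (2 ^ m - 1) := h
  by_cases hy : y = 0
  · subst hy
    rw [zero_pow he] at h
    exact pow_eq_zero_iff he |>.1 h
  have h1 : (x / y) ^ (2 ^ m - 1) = 1 := by
    rw [div_pow, h, div_self (pow_ne_zero _ hy)]
  have h2 : (x / y) ^ 2 ^ m = x / y := by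
    rw [← pow_two_pow_sub_one_mul_self, h1, one_mul]
  rcases eq_zero_or_one_of_pow_eq hmk h2 (hq _) with e | e
  · rw [e, zero_pow he] at h1
    exact (zero_ne_one h1).elim
  · rwa [div_eq_one_iff_eq hy] at e

end FiniteFieldPower

/-! ### Affine equivalence and finite field facts -/

section AffineEquivalence

variable {K : Type*} [Field K] [Algebra (ZMod 2) K]

theorem affine_conj_apn {p : K → K}
    (hp : ∀ {x y a : K}, a ≠ 0 → p (x + a) - p x = p (y + a) - p y → y = x ∨ y = x + a)
    (L₁ L₂ : K ≃ᵃ[ZMod 2] K) {x y a : K} (ha : a ≠ 0)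
    (h : L₁ (p (L₂ (x + a))) - L₁ (p (L₂ x)) = L₁ (p (L₂ (y + a))) - L₁ (p (L₂ y))) :
    y = x ∨ y = x + a := by
  have hsub : ∀ u v : K, L₁ u - L₁ v = L₁.linear (u - v) := fun u v =>
    (L₁.toAffineMap.linearMap_vsub u v).symm
  have hadd : ∀ u : K, L₂ (u + a) = L₂ u + L₂.linear a := fun u => by
    have := L₂.map_vadd u a
    simpa [add_comm] using this
  rw [hsub, hsub] at h
  have h := L₁.linear.injective h
  rw [hadd, hadd] at h
  have ha' : L₂.linear a ≠ 0 := by simpa using ha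
  rcases hp ha' h with e | e
  · exact Or.inl (L₂.injective e)
  · exact Or.inr (L₂.injective (by rw [e, hadd]))

end AffineEquivalence

open Polynomial in
theorem FiniteField.mem_range_algebraMap_of_pow_card_eq {K F : Type*} [Field K] [Fintype K]
    [Field F] [Algebra K F] {x : F} (hx : x ^ Fintype.card K = x) :
    x ∈ Set.range (algebraMap K F) := by
  classical
  by_contra hmem
  have hne := FiniteField.X_pow_card_sub_X_ne_zero F (p := Fintype.card K) Fintype.one_lt_card
  have hxm : x ∉ Finset.univ.image (algebraMap K F) := by
    simpa using hmem
  have hle := card_le_degree_of_subset_roots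
    (Z := insert x (Finset.univ.image (algebraMap K F)))
    (p := (X ^ Fintype.card K - X : F[X])) (by
      intro y hy
      rw [Finset.mem_val, Finset.mem_insert, Finset.mem_image] at hy
      rw [mem_roots hne, IsRoot, eval_sub, eval_pow, eval_X, sub_eq_zero]
      rcases hy with rfl | ⟨a, -, rfl⟩
      · exact hx
      · rw [← map_pow, FiniteField.pow_card])
  rw [Finset.card_insert_of_notMem hxm,
    Finset.card_image_of_injective _ (algebraMap K F).injective, Finset.card_univ,
    FiniteField.X_pow_card_sub_X_natDegree_eq F Fintype.one_lt_card] at hle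
  omega

theorem pow_dobbertinExp_mul_sq {F : Type*} [Field F] [CharP F 2] (k : ℕ) (x : F) :
    x ^ dobbertinExp k * x ^ 2 = conjNorm (iterateFrobenius F 2 k) x := by
  have h : dobbertinExp k + 2
      = 1 + 2 ^ k + 2 ^ (2 * k) + 2 ^ (3 * k) + 2 ^ (4 * k) := by
    have h1 := Nat.one_le_two_pow (n := k)
    unfold dobbertinExp
    generalize 2 ^ k = q at *
    generalize 2 ^ (2 * k) = q2
    generalize 2 ^ (3 * k) = q3
    generalize 2 ^ (4 * k) = q4
    omega
  rw [← pow_add, h]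
  simp only [conjNorm, iterateFrobenius_def]
  rw [pow_add, pow_add, pow_add, pow_add, pow_one]
  simp only [← pow_mul, ← pow_add]
  congr 3 <;> ring_nf

theorem exists_fixed_relation {K F : Type*} [Field K] [Fintype K] [Field F] [Fintype F]
    [Algebra K F] {φ : F →+* F} (hfix : ∀ c : K, φ (algebraMap K F c) = algebraMap K F c)
    (hcard : Fintype.card F = Fintype.card K ^ 5) (v : Fin 6 → F) :
    ∃ p : Fin 6 → F, (∀ i, φ (p i) = p i) ∧ p ≠ 0 ∧ ∑ i, p i * v i = 0 := by
  have hfin : Module.finrank K F = 5 := by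
    have h := Module.card_eq_pow_finrank (K := K) (V := F)
    rw [hcard] at h
    exact (Nat.pow_right_injective Fintype.one_lt_card h).symm
  have hv : ¬ LinearIndependent K v := fun hv => by
    have := hv.fintype_card_le_finrank
    rw [hfin] at this
    simp at this
  obtain ⟨g, hg, i, hi⟩ := Fintype.not_linearIndependent_iff.1 hv
  refine ⟨fun i => algebraMap K F (g i), fun i => hfix _, fun h => hi ?_, ?_⟩
  · simpa using congrFun h i
  · simpa [Algebra.smul_def] using hg

theorem cube_injOn_of_odd {F : Type*} [Field F] {k : ℕ} (hk : Odd k) {a b : F}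
    (ha : a ^ 2 ^ k = a) (hb : b ^ 2 ^ k = b) (h : a ^ 3 = b ^ 3) : a = b := by
  by_cases hb0 : b = 0
  · subst hb0
    exact pow_eq_zero_iff three_ne_zero |>.1 (by rw [h]; ring)
  have h3 : (a / b) ^ 3 = 1 := by rw [div_pow, h, div_self (pow_ne_zero 3 hb0)]
  obtain ⟨r, hr⟩ : ∃ r, r = a / b := ⟨_, rfl⟩
  rw [← hr] at h3
  have hq : r ^ 2 ^ k = r := by rw [hr, div_pow, ha, hb]
  -- For odd k, 2^k is 2 modulo 3, so a cube root of unity in K satisfies r = r².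
  obtain ⟨j, hj⟩ : ∃ j, 2 ^ k = 3 * j + 2 := by
    obtain ⟨i, rfl⟩ := hk
    have : 2 ^ (2 * i + 1) % 3 = 2 := by
      rw [pow_succ, pow_mul, Nat.mul_mod, Nat.pow_mod]
      norm_num
    generalize 2 ^ (2 * i + 1) = q at *
    exact ⟨q / 3, by omega⟩
  rw [hj, pow_add, pow_mul, h3, one_pow, one_mul] at hq
  have hr0 : r ≠ 0 := by rintro rfl; simp at h3
  have hr1 : r = 1 := by
    refine mul_left_cancel₀ hr0 ?_
    rw [← pow_two, hq, mul_one]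
  rwa [hr, div_eq_one_iff_eq hb0] at hr1

theorem Set.ncard_le_two_of_forall {α : Type*} [Add α] [Finite α] {S : Set α} (a : α)
    (h : ∀ x ∈ S, ∀ y ∈ S, y = x ∨ y = x + a) : S.ncard ≤ 2 := by
  rcases S.eq_empty_or_nonempty with rfl | ⟨x, hx⟩
  · simp
  · refine (Set.ncard_le_ncard (t := {x, x + a}) (fun y hy => ?_) (Set.toFinite _)).trans
      (Set.ncard_insert_le _ _ |>.trans ?_)
    · simpa using h x hx y hy
    · simp

/-! ### Gluing the two functions -/

section Modified

variable {F : Type*} [Field F] [CharP F 2]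

theorem modifiedDobbertin_of_fixed {k : ℕ} (hk : k ≠ 0) (g : F → F) {x : F} (hx : x ^ 2 ^ k = x) :
    modifiedDobbertin k g x = g x := by
  -- A zero exponent would make the power of zero equal to one.
  have h : 2 ^ (5 * k) - 1 ≠ 0 := by
    have := Nat.one_lt_two_pow (n := 5 * k) (by omega)
    omega
  rw [modifiedDobbertin, hx, CharTwo.add_self_eq_zero, zero_pow h, mul_zero, add_zero]

theorem modifiedDobbertin_of_not_fixed [Fintype F] {k : ℕ} (hF : Fintype.card F = 2 ^ (5 * k))
    (g : F → F) {x : F} (hx : x ^ 2 ^ k ≠ x) :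
    modifiedDobbertin k g x = x ^ dobbertinExp k := by
  have h : x + x ^ 2 ^ k ≠ 0 := fun e => hx (CharTwo.add_eq_zero.1 e).symm
  rw [modifiedDobbertin, ← hF, FiniteField.pow_card_sub_one_eq_one _ h, mul_one, ← add_assoc,
    CharTwo.add_self_eq_zero, zero_add]

/-- A function that is almost perfect nonlinear on a subfield and agrees with the Dobbertin
function outside of it takes each value of its derivative at most four times. -/
theorem ncard_derivative_le_four [Finite F] {φ : F →+* F}
    (h5 : ∀ x, φ (φ (φ (φ (φ x)))) = x) (hsq : ∀ c : F, ∃ r, r ^ 2 = c)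
    (hdep : ∀ v : Fin 6 → F, ∃ p : Fin 6 → F, (∀ i, φ (p i) = p i) ∧ p ≠ 0 ∧ ∑ i, p i * v i = 0)
    {P f : F → F} (hP : ∀ x, P x * x ^ 2 = conjNorm φ x) (hP0 : P 0 = 0)
    (hfP : ∀ x, φ x ≠ x → f x = P x) (hff : ∀ x, φ x = x → φ (f x) = f x)
    (hf : ∀ x y a, φ x = x → φ y = y → φ a = a → a ≠ 0 → f (x + a) + f x = f (y + a) + f y →
      y = x ∨ y = x + a) {a : F} (ha : a ≠ 0) (b : F) :
    {x : F | f (x + a) + f x = b}.ncard ≤ 4 := by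
  have hout : {x : F | f (x + a) + f x = b ∧ φ x ≠ x ∧ φ (x + a) ≠ x + a}.ncard ≤ 2 := by
    refine Set.ncard_le_two_of_forall a ?_
    rintro x ⟨hx, hx1, hx2⟩ y ⟨hy, hy1, hy2⟩
    rw [hfP _ hx1, hfP _ hx2] at hx
    rw [hfP _ hy1, hfP _ hy2] at hy
    exact dobbertin_apn h5 hsq hdep hP hP0 ha (hx.trans hy.symm)
  by_cases hφa : φ a = a
  · have hin : {x : F | f (x + a) + f x = b ∧ φ x = x}.ncard ≤ 2 := by
      refine Set.ncard_le_two_of_forall a ?_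
      rintro x ⟨hx, hx1⟩ y ⟨hy, hy1⟩
      exact hf x y a hx1 hy1 hφa ha (hx.trans hy.symm)
    refine (Set.ncard_le_ncard (t := {x : F | f (x + a) + f x = b ∧ φ x = x} ∪
      {x : F | f (x + a) + f x = b ∧ φ x ≠ x ∧ φ (x + a) ≠ x + a}) ?_ (Set.toFinite _)).trans
      ((Set.ncard_union_le _ _).trans (by omega))
    intro x hx
    by_cases h : φ x = x
    · exact Or.inl ⟨hx, h⟩
    · exact Or.inr ⟨hx, h, by rw [map_add, hφa]; simpa using h⟩
  -- The values of `P` at x + a and y + a, both in the coset a + K, differ by an element of K.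
  · have aux : ∀ x y : F, φ x = x → φ y = y → P (x + a) + f x = P (y + a) + f y → y = x := by
      intro x y hx hy h
      have h1 : φ (x + a) ≠ x + a := by rw [map_add, hx]; simpa using hφa
      have e1 : x + a + (x + y) = y + a := by grind
      have := eq_of_add_fixed h5 hP h1 (e := x + y) (c := f x + f y) (by rw [map_add, hx, hy])
        (by rw [map_add, hff x hx, hff y hy]) (by rw [e1]; grind)
      exact (CharTwo.add_eq_zero.1 this).symm
    have h1 : {x : F | f (x + a) + f x = b ∧ φ x = x}.ncard ≤ 1 := by
      refine Set.ncard_le_one (Set.toFinite _) |>.2 ?_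
      rintro x ⟨hx, hx1⟩ y ⟨hy, hy1⟩
      rw [hfP (x + a) (by rw [map_add, hx1]; simpa using hφa)] at hx
      rw [hfP (y + a) (by rw [map_add, hy1]; simpa using hφa)] at hy
      exact (aux x y hx1 hy1 (hx.trans hy.symm)).symm
    have h2 : {x : F | f (x + a) + f x = b ∧ φ (x + a) = x + a}.ncard ≤ 1 := by
      refine Set.ncard_le_one (Set.toFinite _) |>.2 ?_
      have back : ∀ x : F, x + a + a = x := fun x => CharTwo.add_cancel_right x a
      have nf : ∀ x : F, φ (x + a) = x + a → φ x ≠ x := by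
        intro x h h'
        rw [map_add, h'] at h
        exact hφa (add_left_cancel h)
      rintro x ⟨hx, hx1⟩ y ⟨hy, hy1⟩
      rw [hfP x (nf x hx1)] at hx
      rw [hfP y (nf y hy1)] at hy
      have := aux (x + a) (y + a) hx1 hy1 (by
        rw [back, back, add_comm (P x), add_comm (P y)]
        exact hx.trans hy.symm)
      exact (add_right_cancel this).symm
    refine (Set.ncard_le_ncard (t := ({x : F | f (x + a) + f x = b ∧ φ x = x} ∪
      {x : F | f (x + a) + f x = b ∧ φ (x + a) = x + a}) ∪
      {x : F | f (x + a) + f x = b ∧ φ x ≠ x ∧ φ (x + a) ≠ x + a}) ?_ (Set.toFinite _)).trans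
      ((Set.ncard_union_le _ _).trans ((Nat.add_le_add_right (Set.ncard_union_le _ _) _).trans
        (by omega)))
    intro x hx
    by_cases h : φ x = x
    · exact Or.inl (Or.inl ⟨hx, h⟩)
    by_cases h' : φ (x + a) = x + a
    · exact Or.inl (Or.inr ⟨hx, h'⟩)
    · exact Or.inr ⟨hx, h, h'⟩

end Modified

/-- `K` is the subfield with `2 ^ k` elements of the field `F` with `2 ^ n = 2 ^ (5 * k)` elements,
and `g` is any function on `F` (for example the one given by a polynomial over `K`) that on `K` is
`L₁ ∘ x ^ (2 ^ m - 1) ∘ L₂` with affine permutations `L₁`, `L₂` of `K`. The condition `0 < m` only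
excludes `k = 1`, `m = k - 1 = 0`. -/
theorem mainTheorem3 (k m : ℕ) (hk : Odd k)
    (hm : m = k - 1 ∨ m = (k + 1) / 2 ∨ m = 2) (hm0 : 0 < m)
    (K F : Type*) [Field K] [Fintype K] [Field F] [Fintype F] [Algebra K F] [Algebra (ZMod 2) K]
    (hK : Fintype.card K = 2 ^ k) (hF : Fintype.card F = 2 ^ (5 * k))
    (L₁ L₂ : K ≃ᵃ[ZMod 2] K) (g : F → F)
    (hg : ∀ x : K, g (algebraMap K F x) = algebraMap K F (L₁ ((L₂ x) ^ (2 ^ m - 1)))) :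
    Function.Bijective (modifiedDobbertin k g) ∧
      IsDifferentiallyUniform 4 (modifiedDobbertin k g) := by
  have : CharP K 2 := charP_of_card_eq_prime_pow hK
  have : CharP F 2 := charP_of_card_eq_prime_pow hF
  have hk0 : k ≠ 0 := by rintro rfl; simp at hk
  obtain ⟨φ, hφ⟩ : ∃ φ, φ = iterateFrobenius F 2 k := ⟨_, rfl⟩
  have hφx : ∀ x, φ x = x ^ 2 ^ k := fun x => by rw [hφ, iterateFrobenius_def]
  have hcardF : ∀ x : F, x ^ 2 ^ (5 * k) = x := fun x => by rw [← hF, FiniteField.pow_card]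
  have hcardK : ∀ x : K, x ^ 2 ^ k = x := fun x => by rw [← hK, FiniteField.pow_card]
  have h5 : ∀ x, φ (φ (φ (φ (φ x)))) = x := fun x => by
    simp only [hφx, ← pow_mul, ← pow_add]
    rw [show k + k + k + k + k = 5 * k by ring, hcardF]
  have hsq : ∀ c : F, ∃ r, r ^ 2 = c := fun c => by
    obtain ⟨r, hr⟩ := FiniteField.isSquare_of_char_two (ringChar.eq F 2) c
    exact ⟨r, by rw [hr, pow_two]⟩
  have hfix : ∀ c : K, φ (algebraMap K F c) = algebraMap K F c := fun c => by
    rw [hφx, ← map_pow, hcardK]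
  have hdep := exists_fixed_relation hfix (by rw [hF, hK, ← pow_mul, mul_comm])
  have hrange : ∀ x, φ x = x → ∃ c, algebraMap K F c = x := fun x hx =>
    FiniteField.mem_range_algebraMap_of_pow_card_eq (by rw [hK, ← hφx, hx])
  have hP : ∀ x : F, x ^ dobbertinExp k * x ^ 2 = conjNorm φ x := fun x => by
    rw [hφ, pow_dobbertinExp_mul_sq]
  have hP0 : (0 : F) ^ dobbertinExp k = 0 := by
    refine zero_pow ?_
    have h1 := Nat.one_le_two_pow (n := 4 * k)
    have h2 := Nat.one_le_two_pow (n := 3 * k)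
    unfold dobbertinExp
    generalize 2 ^ (2 * k) = q2
    generalize 2 ^ (3 * k) = q3 at *
    generalize 2 ^ (4 * k) = q4 at *
    omega
  have hin : ∀ c : K, modifiedDobbertin k g (algebraMap K F c)
      = algebraMap K F (L₁ ((L₂ c) ^ (2 ^ m - 1))) := fun c => by
    rw [modifiedDobbertin_of_fixed hk0 g (by rw [← hφx, hfix]), hg]
  have hout : ∀ x, φ x ≠ x → modifiedDobbertin k g x = x ^ dobbertinExp k := fun x hx =>
    modifiedDobbertin_of_not_fixed hF g (by rwa [← hφx])
  constructor
  · have hinj := dobbertin_injective h5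
      (fun a b ha hb => cube_injOn_of_odd hk (by rwa [← hφx]) (by rwa [← hφx])) hP hP0
    -- Both K and its complement are preserved, so injectivity can be checked on each.
    have mixed : ∀ x y, φ x = x → φ y ≠ y →
        modifiedDobbertin k g x ≠ modifiedDobbertin k g y := by
      intro x y hx hy h
      obtain ⟨c, rfl⟩ := hrange x hx
      rw [hin, hout y hy] at h
      exact hy (fixed_of_value_fixed h5 hP (by rw [← h, hfix]))
    refine Finite.injective_iff_bijective.1 fun x y h => ?_
    by_cases hx : φ x = x
    · by_cases hy : φ y = y
      · obtain ⟨c, rfl⟩ := hrange x hx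
        obtain ⟨e, rfl⟩ := hrange y hy
        rw [hin, hin] at h
        have h := L₁.injective ((algebraMap K F).injective h)
        rw [L₂.injective (pow_two_pow_sub_one_injective (coprime_of_exponent hk hm hm0).1 hm0
          hcardK h)]
      · exact (mixed x y hx hy h).elim
    · by_cases hy : φ y = y
      · exact (mixed y x hy hx h.symm).elim
      · rw [hout x hx, hout y hy] at h
        exact hinj h
  · refine Finset.sup_le fun p hp => ?_
    obtain ⟨a, b⟩ := p
    have ha : a ≠ 0 := by simpa using hp
    refine ncard_derivative_le_four h5 hsq hdep hP hP0 hout ?_ ?_ ha b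
    · intro x hx
      obtain ⟨c, rfl⟩ := hrange x hx
      rw [hin, hfix]
    · intro x y a hx hy hφa ha h
      obtain ⟨c, rfl⟩ := hrange x hx
      obtain ⟨e, rfl⟩ := hrange y hy
      obtain ⟨r, rfl⟩ := hrange a hφa
      simp only [← map_add, hin] at h
      have h := (algebraMap K F).injective h
      have hr : r ≠ 0 := by rintro rfl; simp at ha
      have := affine_conj_apn (p := fun x => x ^ (2 ^ m - 1))
        (fun {x y a} ha h => pow_two_pow_sub_one_apn hk hm hm0 hcardK ha
          (by simpa only [CharTwo.sub_eq_add] using h)) L₁ L₂ hr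
          (x := c) (y := e) (by simpa only [CharTwo.sub_eq_add] using h)
      rcases this with e1 | e1
      · left; rw [e1]
      · right; rw [e1, map_add]
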